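/- Let $\mathbf m:[0,\infty)\times\mathbb R\to\mathbb S^2\subset\mathbb R^3$. The half-wave maps equation is $$\partial_t\mathbf m=\mathbf m\times|\nabla|\mathbf m,\qquad |\nabla|\mathbf m=\mathcal H(\partial_x\mathbf m),\qquad \mathcal H f(x)=\mathrm{P.V.}\,\frac1\pi\int_{\mathbb R}\frac{f(y)}{x-y}\,dy. \tag{HWM}$$ A rational solution of (HWM) with $N$ simple poles is a solution of the form $$\mathbf m(t,x)=\mathbf m_0+\sum_{j=1}^N\frac{\mathbf s_j(t)}{x-x_j(t)}+\sum_{j=1}^N\frac{\overline{\mathbf s_j(t)}}{x-\overline{x_j(t)}},\qquad \operatorname{Im}x_j(t)>0, \tag{RAT}$$ with $\mathbf m_0\in\mathbb R^3$, pairwise distinct poles $x_j(t)\in\mathbb C$ and nonzero spins $\mathbf s_j(t)\in\mathbb C^3$. With $\sigma=(\sigma_1,\sigma_2,\sigma_3)$ the Pauli matrices, write $\mathbf s_j(0)\cdot\sigma=e_j\xi_j^{T}$ with half-spins $e_j,\xi_j\in\mathbb C^2$. The spectrum $(v_1,\dots,v_N)$ of $\mathbf m$ is the family of eigenvalues, with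 algebraic multiplicity, of the $N\times N$ Lax matrix $$L_{jj}=\dot x_j(0),\qquad L_{jk}=\frac{e_j\cdot\xi_k}{x_j(0)-x_k(0)}\quad(j\neq k),\qquad a\cdot b=a_1b_1+a_2b_2,$$ which does not depend on the choice of the half-spins. Theorem. Let $N\in\mathbb N$, let $\varepsilon>0$, and let $\omega_1,\dots,\omega_N\in[-1,1]$ be pairwise distinct. Then there is a rational solution $\mathbf m$ of (HWM), of the form (RAT) with $N$ simple poles, defined for all times $t\ge 0$, whose spectrum, suitably numbered, satisfies $|v_j-\omega_j|\le\varepsilon$ for all $j$, and whose poles are differentiable in time and satisfy $$|\dot x_j(t)-\omega_j|\le\varepsilon\qquad\text{for all } t\ge 0 \text{ and all } j .$$ -/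

import Mathlib

open Filter Topology MeasureTheory
open scoped Matrix

noncomputable section

/-- `l` is the Hilbert transform `P.V. (1/π) ∫ f y / (x - y) dy` of `f` at `x`: the truncated
integrals exist and converge to `l`. -/
def IsHilbertTransformAt (f : ℝ → ℝ) (x l : ℝ) : Prop :=
  (∀ δ : ℝ, 0 < δ → IntegrableOn (fun y => f y / (x - y)) {y | δ < |x - y|}) ∧
  Tendsto (fun δ : ℝ => Real.pi⁻¹ * ∫ y in {y | δ < |x - y|}, f y / (x - y)) (𝓝[>] 0) (𝓝 l)

/-- `m t x` is a classical solution, for all times `t ≥ 0`, of the half-wave maps equation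
`∂ₜ m = m × |∇| m`, `|∇| m = H (∂ₓ m)`, with values in the unit sphere of `ℝ³`
(at `t = 0` the time derivative is one-sided). -/
structure IsGlobalHWMSolution (m : ℝ → ℝ → Fin 3 → ℝ) : Prop where
  sphere : ∀ t : ℝ, 0 ≤ t → ∀ x : ℝ, m t x ⬝ᵥ m t x = 1
  differentiable : ∀ t : ℝ, 0 ≤ t → Differentiable ℝ (m t)
  equation : ∀ t : ℝ, 0 ≤ t → ∀ x : ℝ, ∃ h : Fin 3 → ℝ,
    (∀ i, IsHilbertTransformAt (fun y => deriv (m t) y i) x (h i)) ∧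
    HasDerivWithinAt (fun τ => m τ x) (m t x ⨯₃ h) (Set.Ici 0) t

/-- For `t ≥ 0`, `m t` is the rational function
`m₀ + ∑ⱼ sⱼ(t) / (x - xⱼ(t)) + ∑ⱼ conj sⱼ(t) / (x - conj xⱼ(t))`, with `N` distinct simple poles
`xⱼ(t)` in the upper half-plane and nonzero spins `sⱼ(t)`. -/
structure IsRationalWith {N : ℕ} (m : ℝ → ℝ → Fin 3 → ℝ) (m₀ : Fin 3 → ℝ)
    (s : ℝ → Fin N → Fin 3 → ℂ) (x : ℝ → Fin N → ℂ) : Prop where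
  im_pos : ∀ t : ℝ, 0 ≤ t → ∀ j, 0 < (x t j).im
  poles_distinct : ∀ t : ℝ, 0 ≤ t → Function.Injective (x t)
  spin_ne_zero : ∀ t : ℝ, 0 ≤ t → ∀ j, s t j ≠ 0
  expansion : ∀ t : ℝ, 0 ≤ t → ∀ (y : ℝ) (i : Fin 3),
    (m t y i : ℂ) = (m₀ i : ℂ) + ∑ j, s t j i / ((y : ℂ) - x t j)
      + ∑ j, (starRingEnd ℂ) (s t j i) / ((y : ℂ) - (starRingEnd ℂ) (x t j))

/-- The matrix `s · σ` attached to a spin `s`, where `σ` are the Pauli matrices. -/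
def pauliMatrix (s : Fin 3 → ℂ) : Matrix (Fin 2) (Fin 2) ℂ :=
  !![s 2, s 0 - Complex.I * s 1; s 0 + Complex.I * s 1, -s 2]

/-- `e j`, `ξ j` are half-spins of the spins `s j`: `s j · σ = e j (ξ j)ᵀ`, that is
`s j · σ = Diag (e j) * H * Diag (ξ j)` with `H` the all-ones matrix. -/
def AreHalfSpins {N : ℕ} (s : Fin N → Fin 3 → ℂ) (e ξ : Fin N → Fin 2 → ℂ) : Prop :=
  ∀ j, pauliMatrix (s j) = Matrix.diagonal (e j) * Matrix.of (fun _ _ => 1) *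
    Matrix.diagonal (ξ j)

/-- The Lax matrix: the velocities `ẋⱼ` on the diagonal, `(eⱼ · ξₖ) / (xⱼ - xₖ)` off it.
The order of the two half-spins is the one for which the spectrum is conserved when the poles `xⱼ`
of the spins `sⱼ` lie in the upper half-plane, where
`d/dt (sⱼ · σ) = - ∑_{k ≠ j} [sⱼ · σ, sₖ · σ] / (xⱼ - xₖ)²`. -/
def laxMatrix {N : ℕ} (x xdot : Fin N → ℂ) (e ξ : Fin N → Fin 2 → ℂ) :
    Matrix (Fin N) (Fin N) ℂ :=
  Matrix.of fun j k => if j = k then xdot j else (e j ⬝ᵥ ξ k) / (x j - x k)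

/-- `v 1, …, v N` are the eigenvalues, with algebraic multiplicity, of the Lax matrix of the
configuration with spins `s`, poles `x` and pole velocities `xdot`. Different choices of the
half-spins of nonzero spins conjugate the Lax matrix by a diagonal matrix. -/
def IsSpectrum {N : ℕ} (s : Fin N → Fin 3 → ℂ) (x xdot : Fin N → ℂ) (v : Fin N → ℂ) : Prop :=
  ∃ e ξ : Fin N → Fin 2 → ℂ, AreHalfSpins s e ξ ∧
    (laxMatrix x xdot e ξ).charpoly = ∏ j, (Polynomial.X - Polynomial.C (v j))

end

/-! The solution comes from a matrix formula: `m · σ = pauliZ + A + Aᴴ` with `A = E (y - M(t))⁻¹ F`,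
where `M(t) = B + (T + t) W` moves linearly in time, `W = diag(w)` is real and `F = coSpin W E`. All
the algebra follows from the two relations in `LaxRelations`, namely `M - Mᴴ = i EᴴE` and `M W - W
Mᴴ = -i Eᴴ pauliZ E`. Adding a real multiple of `W` to `M` preserves them. By resolvent identities
they give `(m · σ)² = 1` (`mul_self_eq_one`) and the commutator equation (`evolution`). The latter
is the half-wave maps equation, since the poles of `A` lie in the upper half-plane, where the
Hilbert transform multiplies `∂ₓA` by `i` (`isHilbertTransformAt_re_sum`).

The poles are the eigenvalues of `M(t)`. The first relation puts them in the upper half-plane as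
soon as `E` kills no eigenvector (`im_pos`). The Lax matrix is the transpose of `W` written in an
eigenbasis of `M(0)`: off the diagonal by the commutator identity `F E = W M - M W`, on it by
first-order perturbation theory (`eigenvalue_derivative`). The spectrum is therefore exactly `w`.

For large `τ`, `B + τ W = τ (W + τ⁻¹ B)` is a multiple of a small perturbation of a diagonal matrix
with distinct entries, so its eigenvalues are simple and move with velocities close to `w`
(`exists_eigenvalues_add_smul_diagonal`). Starting the clock at a large `T` makes this hold for
every `t ≥ 0`. It remains to solve the relations for `B`, which is possible explicitly for distinct
`w j` in `(-1, 1)` (`exists_laxRelations`). Half of `ε` pays for moving `ω` into the open interval,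
the other half for the velocities. -/

/-! ### Hilbert transform of double poles -/

theorem setOf_lt_abs_sub_eq (x δ : ℝ) :
    {y : ℝ | δ < |x - y|} = Set.Iio (x - δ) ∪ Set.Ioi (x + δ) := by
  ext y
  simp only [Set.mem_ofPred_eq, Set.mem_union, Set.mem_Iio, Set.mem_Ioi, lt_abs]
  constructor
  · rintro (h | h)
    · left; linarith
    · right; linarith
  · rintro (h | h)
    · left; linarith
    · right; linarith

theorem ofReal_sub_ne_zero {a : ℂ} (ha : a.im ≠ 0) (y : ℝ) : (y : ℂ) - a ≠ 0 := by
  intro h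
  apply ha
  have := congrArg Complex.im h
  simpa using this

theorem integrable_inv_sub_sq {a : ℂ} (ha : a.im ≠ 0) :
    Integrable (fun y : ℝ => (((y : ℂ) - a) ^ 2)⁻¹) := by
  have h0 : Integrable (fun y : ℝ => (1 + ((y - a.re) / a.im) ^ 2)⁻¹) :=
    (integrable_inv_one_add_sq.comp_div ha).comp_sub_right a.re
  refine (h0.const_mul ((a.im ^ 2)⁻¹)).mono' ?_ ?_
  · refine Continuous.aestronglyMeasurable ?_
    exact ((by fun_prop : Continuous fun y : ℝ => ((y : ℂ) - a) ^ 2)).inv₀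
      fun y => pow_ne_zero _ (ofReal_sub_ne_zero ha y)
  · refine Eventually.of_forall fun y => le_of_eq ?_
    rw [norm_inv, norm_pow, ← Complex.normSq_eq_norm_sq, Complex.normSq_apply, ← mul_inv]
    refine congrArg _ ?_
    simp only [Complex.sub_re, Complex.sub_im, Complex.ofReal_re, Complex.ofReal_im]
    field_simp
    ring

theorem integrableOn_inv_sub_sq_div {a : ℂ} (ha : a.im ≠ 0) (x : ℝ) {δ : ℝ} (hδ : 0 < δ) :
    IntegrableOn (fun y : ℝ => (((y : ℂ) - a) ^ 2)⁻¹ / ((x : ℂ) - y)) {y | δ < |x - y|} := by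
  have hms : MeasurableSet {y : ℝ | δ < |x - y|} :=
    measurableSet_lt measurable_const (by fun_prop)
  have h := (integrable_inv_sub_sq ha).integrableOn (s := {y | δ < |x - y|})
  refine (h.norm.mul_const δ⁻¹).mono' ?_ ?_
  · simp only [div_eq_mul_inv]
    exact h.aestronglyMeasurable.mul
      (by fun_prop : Measurable fun y : ℝ => ((x : ℂ) - y)⁻¹).aestronglyMeasurable
  · refine (ae_restrict_iff' hms).2 (Eventually.of_forall fun y hy => ?_)
    rw [norm_div, div_eq_mul_inv]
    refine mul_le_mul_of_nonneg_left ?_ (norm_nonneg _)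
    rw [← Complex.ofReal_sub, Complex.norm_real, Real.norm_eq_abs]
    exact inv_anti₀ hδ (le_of_lt hy)

/-- Each logarithm is `log r + log (1 + z / r)`. This makes the primitive of the kernel vanish at
infinity. -/
theorem tendsto_log_ratio_atTop (z w : ℂ) :
    Tendsto (fun r : ℝ => Complex.log (r + z) - Complex.log (r + w)) atTop (𝓝 0) := by
  have key : ∀ z : ℂ, Tendsto (fun r : ℝ => Complex.log (r + z) - (Real.log r : ℂ)) atTop (𝓝 0) := by
    intro z
    have h1 : Tendsto (fun r : ℝ => Complex.log (1 + z * ((r⁻¹ : ℝ) : ℂ))) atTop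
        (𝓝 (Complex.log (1 + z * ((0 : ℝ) : ℂ)))) := by
      have : Tendsto (fun r : ℝ => 1 + z * ((r⁻¹ : ℝ) : ℂ)) atTop (𝓝 (1 + z * ((0 : ℝ) : ℂ))) :=
        tendsto_const_nhds.add (tendsto_const_nhds.mul
          ((Complex.continuous_ofReal.tendsto _).comp tendsto_inv_atTop_zero))
      refine this.clog ?_
      simp [Complex.one_mem_slitPlane]
    simp only [Complex.ofReal_zero, mul_zero, add_zero, Complex.log_one] at h1
    refine h1.congr' ?_
    have h2 : ∀ᶠ r : ℝ in atTop, 1 + z * ((r⁻¹ : ℝ) : ℂ) ≠ 0 := by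
      filter_upwards [eventually_gt_atTop 0, eventually_gt_atTop ‖z‖] with r hr hz h
      have h3 : (r : ℂ) = - z := by
        have hr' : (r : ℂ) ≠ 0 := by exact_mod_cast hr.ne'
        push_cast at h
        field_simp at h
        linear_combination h
      have := congrArg norm h3
      rw [norm_neg, Complex.norm_real, Real.norm_eq_abs, abs_of_pos hr] at this
      linarith
    filter_upwards [h2, eventually_gt_atTop 0] with r hr hr0
    have hr' : (r : ℂ) ≠ 0 := by exact_mod_cast hr0.ne'
    have : (r : ℂ) + z = (r : ℂ) * (1 + z * ((r⁻¹ : ℝ) : ℂ)) := by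
      push_cast; field_simp
    rw [this, Complex.log_ofReal_mul hr0 hr]
    ring
  have := (key z).sub (key w)
  simpa using this

/-- An antiderivative of `(y - a)⁻² / (x - y)` away from `x`; the sign `σ = ±1` selects the side. -/
noncomputable def sqKernelPrimitive (a x σ : ℂ) (y : ℝ) : ℂ :=
  -((x - a) * (y - a))⁻¹
    + ((x - a) ^ 2)⁻¹ * (Complex.log (σ * (y - a)) - Complex.log (σ * (y - x)))

theorem hasDerivAt_sqKernelPrimitive {a σ : ℂ} {x y : ℝ} (hσ : σ ≠ 0) (ha : a.im ≠ 0) (hy : y ≠ x)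
    (h1 : σ * (y - a) ∈ Complex.slitPlane) (h2 : σ * (y - x) ∈ Complex.slitPlane) :
    HasDerivAt (sqKernelPrimitive a x σ) ((((y : ℂ) - a) ^ 2)⁻¹ / ((x : ℂ) - y)) y := by
  have hya := ofReal_sub_ne_zero ha y
  have hxa := ofReal_sub_ne_zero ha x
  have hyx : (y : ℂ) - x ≠ 0 := by
    rw [sub_ne_zero]; exact_mod_cast hy
  have hxy : (x : ℂ) - y ≠ 0 := by
    rw [sub_ne_zero]; exact_mod_cast hy.symm
  have e : ∀ c : ℂ, HasDerivAt (fun z : ℂ => z - c) 1 (y : ℂ) := fun c =>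
    (hasDerivAt_id _).sub_const c
  have d1 := (((e a).const_mul ((x : ℂ) - a)).fun_inv (mul_ne_zero hxa hya)).neg
  have d2 := ((e a).const_mul σ).clog h1
  have d3 := ((e x).const_mul σ).clog h2
  have d := (d1.add ((d2.sub d3).const_mul (((x : ℂ) - a) ^ 2)⁻¹)).comp_ofReal
  refine d.congr_deriv ?_
  field_simp
  ring

theorem sign_mul_ofReal_sub_mem_slitPlane {a : ℂ} (ha : a.im ≠ 0) (y : ℝ) {σ : ℂ}
    (hσ : σ = 1 ∨ σ = -1) : σ * (y - a) ∈ Complex.slitPlane := by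
  refine Complex.mem_slitPlane_iff.2 (Or.inr ?_)
  rcases hσ with rfl | rfl <;> simpa using ha

theorem setIntegral_inv_sub_sq_div {a : ℂ} (ha : a.im ≠ 0) (x : ℝ) {δ : ℝ} (hδ : 0 < δ) :
    ∫ y in {y | δ < |x - y|}, (((y : ℂ) - a) ^ 2)⁻¹ / ((x : ℂ) - y)
      = sqKernelPrimitive a x (-1) (x - δ) - sqKernelPrimitive a x 1 (x + δ) := by
  have hint := integrableOn_inv_sub_sq_div ha x hδ
  rw [setOf_lt_abs_sub_eq x δ] at hint ⊢
  have hdisj : Disjoint (Set.Iio (x - δ)) (Set.Ioi (x + δ)) := by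
    refine Set.disjoint_left.2 fun y h1 h2 => ?_
    simp only [Set.mem_Iio, Set.mem_Ioi] at h1 h2
    linarith
  have hzero : Tendsto (fun r : ℝ => ((x : ℂ) - a)⁻¹ * ((r : ℂ) - a)⁻¹) (cocompact ℝ) (𝓝 0) := by
    have h : Tendsto (fun r : ℝ => (r : ℂ) - a) (cocompact ℝ) (cocompact ℂ) := by
      rw [← Metric.cobounded_eq_cocompact (α := ℂ), ← tendsto_norm_atTop_iff_cobounded]
      refine tendsto_atTop_mono (f := fun r : ℝ => ‖r‖ - ‖a‖) (fun r => ?_) ?_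
      · have := norm_sub_norm_le (r : ℂ) a
        simpa using this
      · exact tendsto_atTop_add_const_right _ _ tendsto_norm_cocompact_atTop
    have := (tendsto_inv₀_cobounded (α := ℂ))
    rw [Metric.cobounded_eq_cocompact] at this
    simpa using (this.comp h).const_mul ((x : ℂ) - a)⁻¹
  rw [setIntegral_union hdisj measurableSet_Ioi (hint.mono_set Set.subset_union_left)
    (hint.mono_set Set.subset_union_right), ← integral_Iic_eq_integral_Iio]
  have hR : ∫ y in Set.Ioi (x + δ), (((y : ℂ) - a) ^ 2)⁻¹ / ((x : ℂ) - y)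
      = 0 - sqKernelPrimitive a x 1 (x + δ) := by
    have hd : ∀ y ∈ Set.Ici (x + δ), HasDerivAt (sqKernelPrimitive a x 1)
        ((((y : ℂ) - a) ^ 2)⁻¹ / ((x : ℂ) - y)) y := by
      intro y hy
      have hy' : x + δ ≤ y := hy
      refine hasDerivAt_sqKernelPrimitive one_ne_zero ha (by linarith)
        (sign_mul_ofReal_sub_mem_slitPlane ha y (Or.inl rfl)) ?_
      rw [one_mul, ← Complex.ofReal_sub, Complex.ofReal_mem_slitPlane]
      linarith
    refine integral_Ioi_of_hasDerivAt_of_tendsto' hd (hint.mono_set Set.subset_union_right) ?_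
    have h1 := (hzero.mono_left atTop_le_cocompact).neg
    have h2 := (tendsto_log_ratio_atTop (-a) (-x)).const_mul (((x : ℂ) - a) ^ 2)⁻¹
    have := h1.add h2
    simp only [neg_zero, mul_zero, add_zero] at this
    refine this.congr fun y => ?_
    simp [sqKernelPrimitive, sub_eq_add_neg, mul_comm]
  have hL : ∫ y in Set.Iic (x - δ), (((y : ℂ) - a) ^ 2)⁻¹ / ((x : ℂ) - y)
      = sqKernelPrimitive a x (-1) (x - δ) - 0 := by
    have hd : ∀ y ∈ Set.Iic (x - δ), HasDerivAt (sqKernelPrimitive a x (-1))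
        ((((y : ℂ) - a) ^ 2)⁻¹ / ((x : ℂ) - y)) y := by
      intro y hy
      have hy' : y ≤ x - δ := hy
      refine hasDerivAt_sqKernelPrimitive (by norm_num) ha (by linarith)
        (sign_mul_ofReal_sub_mem_slitPlane ha y (Or.inr rfl)) ?_
      rw [neg_one_mul, ← Complex.ofReal_sub, ← Complex.ofReal_neg, Complex.ofReal_mem_slitPlane]
      linarith
    refine integral_Iic_of_hasDerivAt_of_tendsto' hd
      (hint.mono_set Set.subset_union_left |>.congr_set_ae Iio_ae_eq_Iic.symm) ?_
    have h1 := (hzero.mono_left atBot_le_cocompact).neg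
    have h2 := ((tendsto_log_ratio_atTop a x).comp tendsto_neg_atBot_atTop).const_mul
      (((x : ℂ) - a) ^ 2)⁻¹
    have := h1.add h2
    simp only [neg_zero, mul_zero, add_zero] at this
    refine this.congr fun y => ?_
    simp [sqKernelPrimitive, sub_eq_add_neg, mul_comm, add_comm]
  rw [hR, hL]
  ring

theorem tendsto_setIntegral_inv_sub_sq_div {a : ℂ} (ha : 0 < a.im) (x : ℝ) :
    Tendsto (fun δ : ℝ => ∫ y in {y | δ < |x - y|}, (((y : ℂ) - a) ^ 2)⁻¹ / ((x : ℂ) - y))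
      (𝓝[>] 0) (𝓝 (Real.pi * (Complex.I * (((x : ℂ) - a) ^ 2)⁻¹))) := by
  -- Since `x - a` lies in the lower half-plane, negation raises its argument by exactly `π`. This
  -- jump of the logarithm is the whole principal value.
  have hlog : Complex.log (-1 * (x - a)) - Complex.log (1 * (x - a)) = Real.pi * Complex.I := by
    rw [neg_one_mul, one_mul, Complex.log, Complex.log, Complex.arg_neg_eq_arg_add_pi_of_im_neg, norm_neg]
    · push_cast; ring
    · simpa using ha
  -- The singular terms of the two primitives are both `log δ` and cancel; `G` is what is left, and
  -- it is continuous at `δ = 0`.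
  set G : ℝ → ℂ := fun δ => -((x - a) * (((x - δ : ℝ) : ℂ) - a))⁻¹
    + ((x - a) * (((x + δ : ℝ) : ℂ) - a))⁻¹ + (((x : ℂ) - a) ^ 2)⁻¹ *
      (Complex.log (-1 * (((x - δ : ℝ) : ℂ) - a)) - Complex.log (1 * (((x + δ : ℝ) : ℂ) - a)))
    with hG
  have hcont : ContinuousAt G 0 := by
    refine ContinuousAt.add (ContinuousAt.add ?_ ?_) (continuousAt_const.mul (ContinuousAt.sub ?_ ?_))
    · refine ContinuousAt.neg (ContinuousAt.inv₀ (by fun_prop)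
        (mul_ne_zero (ofReal_sub_ne_zero ha.ne' x) (ofReal_sub_ne_zero ha.ne' _)))
    · exact (ContinuousAt.inv₀ (by fun_prop) (mul_ne_zero (ofReal_sub_ne_zero ha.ne' x)
        (ofReal_sub_ne_zero ha.ne' _)))
    · exact ContinuousAt.clog (by fun_prop) (sign_mul_ofReal_sub_mem_slitPlane ha.ne' _ (Or.inr rfl))
    · exact ContinuousAt.clog (by fun_prop) (sign_mul_ofReal_sub_mem_slitPlane ha.ne' _ (Or.inl rfl))
  have hG0 : G 0 = Real.pi * (Complex.I * (((x : ℂ) - a) ^ 2)⁻¹) := by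
    simp only [hG, sub_zero, add_zero, hlog]
    ring
  rw [← hG0]
  refine (hcont.tendsto.mono_left nhdsWithin_le_nhds).congr' ?_
  filter_upwards [self_mem_nhdsWithin] with δ hδ
  rw [setIntegral_inv_sub_sq_div ha.ne' x hδ]
  simp only [hG, sqKernelPrimitive]
  have e1 : (-1 : ℂ) * (((x - δ : ℝ) : ℂ) - x) = δ := by push_cast; ring
  have e2 : (1 : ℂ) * (((x + δ : ℝ) : ℂ) - x) = δ := by push_cast; ring
  rw [e1, e2]
  ring

/-- A sum of double poles in the upper half-plane is an eigenfunction of the Hilbert transform. -/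
theorem isHilbertTransformAt_re_sum {ι : Type*} [Fintype ι] (c a : ι → ℂ) (ha : ∀ j, 0 < (a j).im)
    (x : ℝ) :
    IsHilbertTransformAt (fun y : ℝ => (∑ j, c j * (((y : ℂ) - a j) ^ 2)⁻¹).re) x
      (Complex.I * ∑ j, c j * (((x : ℂ) - a j) ^ 2)⁻¹).re := by
  have hform : ∀ y : ℝ, (∑ j, c j * (((y : ℂ) - a j) ^ 2)⁻¹).re / (x - y)
      = Complex.reCLM (∑ j, c j * ((((y : ℂ) - a j) ^ 2)⁻¹ / ((x : ℂ) - y))) := by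
    intro y
    rw [Complex.reCLM_apply, ← Complex.div_ofReal_re]
    congr 1
    push_cast
    rw [Finset.sum_div]
    exact Finset.sum_congr rfl fun j _ => mul_div_assoc _ _ _
  have hint : ∀ δ : ℝ, 0 < δ → IntegrableOn
      (fun y : ℝ => ∑ j, c j * ((((y : ℂ) - a j) ^ 2)⁻¹ / ((x : ℂ) - y))) {y | δ < |x - y|} :=
    fun δ hδ => integrable_finsetSum _ fun j _ =>
      (integrableOn_inv_sub_sq_div (ha j).ne' x hδ).const_mul (c j)
  simp only [IsHilbertTransformAt, hform]
  refine ⟨fun δ hδ => Complex.reCLM.integrable_comp (hint δ hδ), ?_⟩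
  have hlim : Tendsto (fun δ : ℝ => (Real.pi : ℂ)⁻¹ * ∑ j, c j * ∫ y in {y | δ < |x - y|},
      (((y : ℂ) - a j) ^ 2)⁻¹ / ((x : ℂ) - y)) (𝓝[>] 0)
      (𝓝 ((Real.pi : ℂ)⁻¹ * ∑ j, c j * (Real.pi * (Complex.I * (((x : ℂ) - a j) ^ 2)⁻¹)))) :=
    (tendsto_finsetSum _ fun j _ =>
      (tendsto_setIntegral_inv_sub_sq_div (ha j) x).const_mul (c j)).const_mul _
  have hpi : (Real.pi : ℂ) ≠ 0 := by exact_mod_cast Real.pi_ne_zero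
  have hval : (Real.pi : ℂ)⁻¹ * ∑ j, c j * (Real.pi * (Complex.I * (((x : ℂ) - a j) ^ 2)⁻¹))
      = Complex.I * ∑ j, c j * (((x : ℂ) - a j) ^ 2)⁻¹ := by
    rw [Finset.mul_sum, Finset.mul_sum]
    refine Finset.sum_congr rfl fun j _ => ?_
    field_simp
  rw [hval] at hlim
  refine ((Complex.continuous_re.tendsto _).comp hlim).congr' ?_
  filter_upwards [self_mem_nhdsWithin] with δ hδ
  rw [Function.comp_apply, ContinuousLinearMap.integral_comp_comm _ (hint δ hδ),
    Complex.reCLM_apply, integral_finsetSum _ fun j _ =>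
      (integrableOn_inv_sub_sq_div (ha j).ne' x hδ).const_mul (c j)]
  simp only [integral_const_mul]
  rw [← Complex.ofReal_inv, Complex.re_ofReal_mul]

/-! ### Pauli coordinates -/

/-- The coordinates of the traceless part of a `2 × 2` matrix in the basis of Pauli matrices. -/
noncomputable def pauliCoord : Matrix (Fin 2) (Fin 2) ℂ →ₗ[ℂ] (Fin 3 → ℂ) where
  toFun S := ![(S 0 1 + S 1 0) / 2, Complex.I * (S 0 1 - S 1 0) / 2, (S 0 0 - S 1 1) / 2]
  map_add' S T := by
    ext i; fin_cases i <;> simp <;> ring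
  map_smul' c S := by
    ext i; fin_cases i <;> simp <;> ring

theorem pauliMatrix_pauliCoord {S : Matrix (Fin 2) (Fin 2) ℂ} (hS : S.trace = 0) :
    pauliMatrix (pauliCoord S) = S := by
  have h : S 1 1 = - S 0 0 := by
    rw [Matrix.trace_fin_two] at hS
    linear_combination hS
  ext i j
  fin_cases i <;> fin_cases j <;> simp [pauliMatrix, pauliCoord, h]
  · linear_combination (-(S 0 1 - S 1 0) / 2) * Complex.I_sq
  · linear_combination ((S 0 1 - S 1 0) / 2) * Complex.I_sq

theorem pauliCoord_conjTranspose (S : Matrix (Fin 2) (Fin 2) ℂ) (i : Fin 3) :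
    pauliCoord Sᴴ i = (starRingEnd ℂ) (pauliCoord S i) := by
  have h2 : (starRingEnd ℂ) 2 = 2 := map_ofNat _ 2
  fin_cases i <;> simp [pauliCoord, h2]
  all_goals ring

theorem dotProduct_self_eq_one_of_pauliMatrix_mul_self {m : Fin 3 → ℂ}
    (h : pauliMatrix m * pauliMatrix m = 1) : m ⬝ᵥ m = 1 := by
  have := congrFun (congrFun h 0) 0
  simp [pauliMatrix, Matrix.mul_apply, Fin.sum_univ_two] at this
  simp [dotProduct, Fin.sum_univ_three]
  linear_combination this + m 1 * m 1 * Complex.I_sq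

theorem pauliMatrix_cross (m h : Fin 3 → ℂ) :
    pauliMatrix (m ⨯₃ h) = (-Complex.I / 2) •
      (pauliMatrix m * pauliMatrix h - pauliMatrix h * pauliMatrix m) := by
  have hI := Complex.I_sq
  ext i j
  fin_cases i <;> fin_cases j <;>
    simp [pauliMatrix, cross_apply]
  · linear_combination (m 0 * h 1 - m 1 * h 0) * hI
  · linear_combination (m 1 * h 2 - m 2 * h 1) * hI
  · linear_combination (m 1 * h 2 - m 2 * h 1) * hI
  · linear_combination (m 1 * h 0 - m 0 * h 1) * hI

theorem pauliCoord_pauliMatrix (m : Fin 3 → ℂ) : pauliCoord (pauliMatrix m) = m := by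
  ext i
  fin_cases i <;> simp [pauliMatrix, pauliCoord]
  linear_combination (- m 1) * Complex.I_sq

/-- The value at infinity `diag(1, -1)` of the matrix `m · σ`. -/
def pauliZ : Matrix (Fin 2) (Fin 2) ℂ := Matrix.diagonal ![1, -1]

theorem pauliZ_mul_self : pauliZ * pauliZ = 1 := by
  ext i j
  fin_cases i <;> fin_cases j <;> simp [pauliZ]

theorem pauliZ_conjTranspose : pauliZᴴ = pauliZ := by
  ext i j
  fin_cases i <;> fin_cases j <;> simp [pauliZ]

theorem pauliZ_trace : pauliZ.trace = 0 := by
  simp [pauliZ]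

/-! ### Matrix relations and resolvent identities -/

section Algebra

variable {n : Type*} [Fintype n]

/-- The compatibility relations between a matrix `M`, whose eigenvalues are the poles, a Hermitian
matrix `W`, whose eigenvalues are the spectrum, and the matrix `E` of half-spins. -/
structure LaxRelations (M W : Matrix n n ℂ) (E : Matrix (Fin 2) n ℂ) : Prop where
  hermitian : Wᴴ = W
  sub_conj : M - Mᴴ = Complex.I • (Eᴴ * E)
  mul_sub_conj : M * W - W * Mᴴ = -Complex.I • (Eᴴ * pauliZ * E)

/-- The second matrix of half-spins. -/
noncomputable def coSpin (W : Matrix n n ℂ) (E : Matrix (Fin 2) n ℂ) : Matrix n (Fin 2) ℂ :=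
  Complex.I • (W * Eᴴ + Eᴴ * pauliZ)

namespace LaxRelations

variable {M W : Matrix n n ℂ} {E : Matrix (Fin 2) n ℂ}

/-- As `W` is Hermitian and `τ` real, the new terms cancel in both relations. Hence the flow of `M`
is linear, with `E`, `W` and `F` constant in time. -/
theorem add_smul (h : LaxRelations M W E) (τ : ℝ) : LaxRelations (M + (τ : ℂ) • W) W E where
  hermitian := h.hermitian
  sub_conj := by
    rw [← h.sub_conj, Matrix.conjTranspose_add, Matrix.conjTranspose_smul, h.hermitian]
    simp
  mul_sub_conj := by
    rw [← h.mul_sub_conj, Matrix.conjTranspose_add, Matrix.conjTranspose_smul, h.hermitian]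
    simp [add_mul, mul_add]

theorem coSpin_mul (h : LaxRelations M W E) : coSpin W E * E = W * M - M * W := by
  have h1 := h.mul_sub_conj
  have h2 : W * (M - Mᴴ) = W * (Complex.I • (Eᴴ * E)) := by rw [h.sub_conj]
  rw [mul_sub, Matrix.mul_smul] at h2
  have h3 : coSpin W E * E = Complex.I • (W * (Eᴴ * E)) - -Complex.I • (Eᴴ * pauliZ * E) := by
    simp [coSpin, Matrix.add_mul, Matrix.mul_assoc, smul_add]
  rw [h3, ← h1, ← h2]
  abel

theorem conjTranspose_coSpin (h : LaxRelations M W E) :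
    (coSpin W E)ᴴ = -Complex.I • (E * W + pauliZ * E) := by
  simp [coSpin, Matrix.conjTranspose_smul, h.hermitian, pauliZ_conjTranspose]

theorem mul_spectral (h : LaxRelations M W E) :
    E * W = Complex.I • (coSpin W E)ᴴ - pauliZ * E := by
  rw [h.conjTranspose_coSpin, smul_smul]
  simp

/-- By cyclicity this is the trace of `R` times a commutator with `M`. It serves to show that the `2
× 2` matrices involved are traceless, hence of the form `m · σ`. -/
theorem trace_eq_zero_of_comm {R : Matrix n n ℂ} (h : LaxRelations M W E) (hc : R * M = M * R) :
    (E * R * coSpin W E).trace = 0 := by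
  rw [Matrix.trace_mul_comm, ← Matrix.mul_assoc, h.coSpin_mul, sub_mul, Matrix.trace_sub,
    mul_assoc M, Matrix.trace_mul_comm M, mul_assoc W, mul_assoc W, hc, sub_self]

variable [DecidableEq n]

/-- Up to a defect carried by `W² - 1`, `W` acts on the second half-spins as `pauliZ` does; this
uses only `pauliZ² = 1`. -/
theorem spectral_mul_coSpin :
    W * coSpin W E = coSpin W E * pauliZ + Complex.I • ((W * W - 1) * Eᴴ) := by
  simp only [coSpin, Matrix.mul_smul, Matrix.smul_mul, ← smul_add]
  congr 1
  simp only [Matrix.mul_add, Matrix.add_mul, Matrix.mul_assoc, Matrix.sub_mul, Matrix.one_mul,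
    pauliZ_mul_self, Matrix.mul_one]
  abel

/-- The counterpart for `F` of the relation for `Eᴴ E`: the Gram matrix is again a twisted
difference of `M` and `Mᴴ`, so that resolvents on its two sides telescope. -/
theorem coSpin_mul_conjTranspose (h : LaxRelations M W E) :
    coSpin W E * (coSpin W E)ᴴ =
      M * (Complex.I • (W * W - 1)) - (Complex.I • (W * W - 1)) * Mᴴ := by
  have e1 : coSpin W E * (coSpin W E)ᴴ
      = -Complex.I • (coSpin W E * E * W + coSpin W E * pauliZ * E) := by
    rw [h.conjTranspose_coSpin, Matrix.mul_smul, Matrix.mul_add, ← Matrix.mul_assoc,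
      ← Matrix.mul_assoc]
  have e2 : coSpin W E * pauliZ = W * coSpin W E - Complex.I • ((W * W - 1) * Eᴴ) := by
    rw [spectral_mul_coSpin]; abel
  have e3 : (Complex.I • ((W * W - 1) * Eᴴ)) * E = (W * W - 1) * (M - Mᴴ) := by
    rw [h.sub_conj]
    simp [Matrix.mul_assoc]
  rw [e1, e2, Matrix.sub_mul, e3, Matrix.mul_assoc W, h.coSpin_mul]
  simp only [Matrix.mul_smul, Matrix.smul_mul, neg_smul, ← smul_sub, ← smul_neg]
  congr 1
  noncomm_ring

section Resolvent

variable {R : Matrix n n ℂ} {y : ℝ}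

theorem resolvent_sandwich (h : LaxRelations M W E) (hR : R * ((y : ℂ) • 1 - M) = 1)
    (hR' : ((y : ℂ) • 1 - M) * R = 1) : R * (coSpin W E * E) * R = W * R - R * W := by
  rw [h.coSpin_mul]
  have : W * M - M * W = ((y : ℂ) • 1 - M) * W - W * ((y : ℂ) • 1 - M) := by
    simp [sub_mul, mul_sub]
  rw [this, mul_sub, sub_mul, ← mul_assoc, hR, one_mul, mul_assoc R, mul_assoc W, hR', mul_one]

theorem conjTranspose_resolvent (hR' : ((y : ℂ) • 1 - M) * R = 1) :
    Rᴴ * ((y : ℂ) • 1 - Mᴴ) = 1 := by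
  have := congrArg Matrix.conjTranspose hR'
  simpa [Matrix.conjTranspose_mul, Matrix.conjTranspose_smul] using this

theorem conjTranspose_resolvent' (hR : R * ((y : ℂ) • 1 - M) = 1) :
    ((y : ℂ) • 1 - Mᴴ) * Rᴴ = 1 := by
  have := congrArg Matrix.conjTranspose hR
  simpa [Matrix.conjTranspose_mul, Matrix.conjTranspose_smul] using this

/-- For real `y`, `Eᴴ E` is `i` times the difference of `y - M` and its adjoint, so the product
collapses as in the resolvent identity. -/
theorem resolvent_gram (h : LaxRelations M W E)
    (hR' : ((y : ℂ) • 1 - M) * R = 1) : Rᴴ * (Eᴴ * E) * R = Complex.I • (Rᴴ - R) := by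
  have h1 : Eᴴ * E = Complex.I • (((y : ℂ) • 1 - M) - ((y : ℂ) • 1 - Mᴴ)) := by
    have : ((y : ℂ) • (1 : Matrix n n ℂ) - M) - ((y : ℂ) • 1 - Mᴴ) = -(M - Mᴴ) := by abel
    rw [this, h.sub_conj, smul_neg, smul_smul]
    simp
  rw [h1, Matrix.mul_smul, Matrix.smul_mul, mul_sub, sub_mul, conjTranspose_resolvent hR',
    mul_assoc, hR', mul_one, one_mul]

theorem resolvent_cogram (h : LaxRelations M W E) (hR : R * ((y : ℂ) • 1 - M) = 1) :
    R * (coSpin W E * (coSpin W E)ᴴ) * Rᴴ =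
      R * (Complex.I • (W * W - 1)) - (Complex.I • (W * W - 1)) * Rᴴ := by
  set Z := Complex.I • (W * W - 1) with hZ
  have h1 : coSpin W E * (coSpin W E)ᴴ
      = Z * ((y : ℂ) • 1 - Mᴴ) - ((y : ℂ) • 1 - M) * Z := by
    rw [h.coSpin_mul_conjTranspose, ← hZ]
    clear_value Z
    simp [mul_sub, sub_mul]
  rw [h1, mul_sub, sub_mul, ← mul_assoc R, mul_assoc (R * Z), conjTranspose_resolvent' hR, ← mul_assoc R,
    hR, one_mul, mul_one]

/-- The matrix `m · σ` has square one. -/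
theorem mul_self_eq_one (h : LaxRelations M W E) (hR : R * ((y : ℂ) • 1 - M) = 1)
    (hR' : ((y : ℂ) • 1 - M) * R = 1) :
    (pauliZ + E * R * coSpin W E + (E * R * coSpin W E)ᴴ) *
      (pauliZ + E * R * coSpin W E + (E * R * coSpin W E)ᴴ) = 1 := by
  set F := coSpin W E with hF
  set Z := Complex.I • (W * W - 1) with hZ
  have hZH : Zᴴ = -Z := by simp [hZ, h.hermitian, Matrix.conjTranspose_smul]
  have hWF : W * F = F * pauliZ + Z * Eᴴ := by
    rw [spectral_mul_coSpin, hZ, Matrix.smul_mul]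
  -- The terms of the square built from `A` alone do not vanish; their two remainders and the
  -- adjoint ones are cancelled by the mixed products `Aᴴ A` (`hG`) and `A Aᴴ` (`hC`).
  have hA : pauliZ * (E * R * F) + E * R * F * pauliZ + E * R * F * (E * R * F)
      = Complex.I • (Fᴴ * R * F) - E * R * Z * Eᴴ := by
    have e : E * R * F * (E * R * F) = E * W * (R * F) - E * R * (W * F) := by
      calc E * R * F * (E * R * F) = E * (R * (F * E) * R) * F := by
            simp only [Matrix.mul_assoc]
        _ = _ := by
            rw [h.resolvent_sandwich hR hR']
            simp only [Matrix.mul_assoc, Matrix.mul_sub, Matrix.sub_mul]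
    rw [e, h.mul_spectral, hWF]
    simp only [Matrix.mul_assoc, Matrix.mul_add, Matrix.sub_mul, Matrix.smul_mul]
    abel
  have hA' := congrArg Matrix.conjTranspose hA
  simp only [Matrix.conjTranspose_add, Matrix.conjTranspose_sub, Matrix.conjTranspose_mul,
    Matrix.conjTranspose_smul, pauliZ_conjTranspose, Matrix.conjTranspose_conjTranspose, hZH] at hA'
  have hG : (E * R * F)ᴴ * (E * R * F) = Complex.I • (Fᴴ * Rᴴ * F) - Complex.I • (Fᴴ * R * F) := by
    calc (E * R * F)ᴴ * (E * R * F) = Fᴴ * (Rᴴ * (Eᴴ * E) * R) * F := by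
          simp only [Matrix.mul_assoc, Matrix.conjTranspose_mul]
      _ = _ := by
          rw [h.resolvent_gram hR']
          simp only [Matrix.mul_assoc, Matrix.mul_sub, Matrix.sub_mul, Matrix.smul_mul,
            Matrix.mul_smul, smul_sub]
  have hC : (E * R * F) * (E * R * F)ᴴ = E * R * Z * Eᴴ - E * Z * Rᴴ * Eᴴ := by
    calc (E * R * F) * (E * R * F)ᴴ = E * (R * (F * Fᴴ) * Rᴴ) * Eᴴ := by
          simp only [Matrix.mul_assoc, Matrix.conjTranspose_mul]
      _ = _ := by
          rw [h.resolvent_cogram hR, ← hZ]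
          simp only [Matrix.mul_assoc, Matrix.mul_sub, Matrix.sub_mul]
  have hsum : ∀ U A B : Matrix (Fin 2) (Fin 2) ℂ, (U + A + B) * (U + A + B)
      = U * U + (U * A + A * U + A * A) + (B * U + U * B + B * B) + B * A + A * B := by
    intro U A B; noncomm_ring
  have hA'' : (E * R * F)ᴴ * pauliZ + pauliZ * (E * R * F)ᴴ + (E * R * F)ᴴ * (E * R * F)ᴴ
      = E * Z * Rᴴ * Eᴴ - Complex.I • (Fᴴ * Rᴴ * F) := by
    simp only [Matrix.conjTranspose_mul, Matrix.mul_assoc] at hA' ⊢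
    rw [hA']
    simp
    abel
  rw [hsum, hA, hA'', hG, hC, pauliZ_mul_self]
  abel

/-- The evolution equation `∂ₜ U = ½ [U, ∂ₓ A - ∂ₓ Aᴴ]` for `U = m · σ`. -/
theorem evolution (h : LaxRelations M W E) (hR : R * ((y : ℂ) • 1 - M) = 1)
    (hR' : ((y : ℂ) • 1 - M) * R = 1) {U A Ax At : Matrix (Fin 2) (Fin 2) ℂ}
    (hAdef : A = E * R * coSpin W E) (hU : U = pauliZ + A + Aᴴ)
    (hAxdef : Ax = -(E * (R * R) * coSpin W E)) (hAtdef : At = E * (R * W * R) * coSpin W E) :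
    U * (Ax - Axᴴ) - (Ax - Axᴴ) * U = (2 : ℂ) • (At + Atᴴ) := by
  set F := coSpin W E with hF
  set Z := Complex.I • (W * W - 1) with hZ
  have hZH : Zᴴ = -Z := by simp [hZ, h.hermitian, Matrix.conjTranspose_smul]
  have hWF : W * F = F * pauliZ + Z * Eᴴ := by
    rw [spectral_mul_coSpin, hZ, Matrix.smul_mul]
  have hA : (pauliZ + A) * Ax - Ax * (pauliZ + A)
      = (2 : ℂ) • At - Complex.I • (Fᴴ * (R * R) * F) - E * (R * R) * Z * Eᴴ := by
    have e1 : A * Ax = -(E * W * (R * R * F)) + At := by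
      calc A * Ax = -(E * (R * (F * E) * R) * (R * F)) := by
            rw [hAdef, hAxdef]; simp only [Matrix.mul_assoc, Matrix.mul_neg]
        _ = _ := by
            rw [h.resolvent_sandwich hR hR', hAtdef]
            simp only [Matrix.mul_assoc, Matrix.mul_sub, Matrix.sub_mul]
            abel
    have e2 : Ax * A = -At + E * (R * R) * (W * F) := by
      calc Ax * A = -(E * R * (R * (F * E) * R) * F) := by
            rw [hAdef, hAxdef]; simp only [Matrix.mul_assoc, Matrix.neg_mul]
        _ = _ := by
            rw [h.resolvent_sandwich hR hR', hAtdef]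
            simp only [Matrix.mul_assoc, Matrix.mul_sub, Matrix.sub_mul]
            abel
    rw [add_mul, mul_add, e1, e2, h.mul_spectral, hWF, hAxdef, two_smul]
    simp only [Matrix.mul_assoc, Matrix.mul_add, Matrix.sub_mul, Matrix.smul_mul, Matrix.mul_neg,
      Matrix.neg_mul]
    abel
  have hA'' : (pauliZ + Aᴴ) * Axᴴ - Axᴴ * (pauliZ + Aᴴ)
      = -((2 : ℂ) • Atᴴ) - Complex.I • (Fᴴ * (Rᴴ * Rᴴ) * F) - E * Z * (Rᴴ * Rᴴ) * Eᴴ := by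
    have hA' := congrArg Matrix.conjTranspose hA
    simp only [Matrix.conjTranspose_add, Matrix.conjTranspose_sub, Matrix.conjTranspose_mul,
      Matrix.conjTranspose_smul, pauliZ_conjTranspose, Matrix.conjTranspose_conjTranspose, hZH]
      at hA'
    rw [← neg_inj, neg_sub, hA']
    simp [Matrix.mul_assoc]
    abel
  have hG : Aᴴ * Ax + Axᴴ * A
      = Complex.I • (Fᴴ * (R * R) * F) - Complex.I • (Fᴴ * (Rᴴ * Rᴴ) * F) := by
    have e1 : Aᴴ * Ax = -(Fᴴ * (Rᴴ * (Eᴴ * E) * R) * (R * F)) := by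
      rw [hAdef, hAxdef]
      simp only [Matrix.mul_assoc, Matrix.conjTranspose_mul, Matrix.mul_neg]
    have e2 : Axᴴ * A = -(Fᴴ * Rᴴ * (Rᴴ * (Eᴴ * E) * R) * F) := by
      rw [hAdef, hAxdef]
      simp only [Matrix.mul_assoc, Matrix.conjTranspose_mul, Matrix.conjTranspose_neg,
        Matrix.neg_mul]
    rw [e1, e2, h.resolvent_gram hR']
    simp only [Matrix.mul_assoc, Matrix.mul_sub, Matrix.sub_mul, Matrix.smul_mul,
      Matrix.mul_smul, smul_sub]
    abel
  have hC : Ax * Aᴴ + A * Axᴴ = E * Z * (Rᴴ * Rᴴ) * Eᴴ - E * (R * R) * Z * Eᴴ := by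
    have e1 : Ax * Aᴴ = -(E * R * (R * (F * Fᴴ) * Rᴴ) * Eᴴ) := by
      rw [hAdef, hAxdef]
      simp only [Matrix.mul_assoc, Matrix.conjTranspose_mul, Matrix.neg_mul]
    have e2 : A * Axᴴ = -(E * (R * (F * Fᴴ) * Rᴴ) * (Rᴴ * Eᴴ)) := by
      rw [hAdef, hAxdef]
      simp only [Matrix.mul_assoc, Matrix.conjTranspose_mul, Matrix.conjTranspose_neg,
        Matrix.mul_neg]
    rw [e1, e2, h.resolvent_cogram hR, ← hZ]
    simp only [Matrix.mul_assoc, Matrix.mul_sub, Matrix.sub_mul]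
    abel
  have hsum : U * (Ax - Axᴴ) - (Ax - Axᴴ) * U
      = ((pauliZ + A) * Ax - Ax * (pauliZ + A)) - ((pauliZ + Aᴴ) * Axᴴ - Axᴴ * (pauliZ + Aᴴ))
        + (Aᴴ * Ax + Axᴴ * A) - (Ax * Aᴴ + A * Axᴴ) := by
    rw [hU]; noncomm_ring
  rw [hsum, hA, hA'', hG, hC, smul_add]
  abel

theorem resolvent_comm (hR : R * ((y : ℂ) • 1 - M) = 1)
    (hR' : ((y : ℂ) • 1 - M) * R = 1) : R * M = M * R := by
  have := hR.trans hR'.symm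
  simpa [mul_sub, sub_mul] using this

end Resolvent

end LaxRelations

end Algebra

/-! ### Eigenvectors, positivity of imaginary parts, simple eigenvalues -/

section Spectral

variable {n : Type*} [Fintype n]

theorem exists_pos_star_dotProduct_self {u : n → ℂ} (hu : u ≠ 0) :
    ∃ r : ℝ, 0 < r ∧ star u ⬝ᵥ u = r := by
  obtain ⟨k, hk⟩ := Function.ne_iff.1 hu
  refine ⟨∑ i, Complex.normSq (u i), ?_, ?_⟩
  · exact Finset.sum_pos' (fun i _ => Complex.normSq_nonneg _)
      ⟨k, Finset.mem_univ k, Complex.normSq_pos.2 hk⟩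
  · simp [dotProduct, Complex.normSq_eq_conj_mul_self]

variable [DecidableEq n]

theorem exists_diagonalization {M : Matrix n n ℂ} {l : n → ℂ} (hl : Function.Injective l)
    (hdet : ∀ j, (l j • (1 : Matrix n n ℂ) - M).det = 0) :
    ∃ V V' : Matrix n n ℂ, V * V' = 1 ∧ V' * V = 1 ∧ M = V * Matrix.diagonal l * V' := by
  choose v hv0 hv using fun j => Matrix.exists_mulVec_eq_zero_iff.2 (hdet j)
  have hMv : ∀ j, M *ᵥ v j = l j • v j := by
    intro j
    have := hv j
    rw [Matrix.sub_mulVec, Matrix.smul_mulVec, Matrix.one_mulVec, sub_eq_zero] at this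
    exact this.symm
  set V : Matrix n n ℂ := Matrix.of fun i j => v j i with hV
  have hli : LinearIndependent ℂ v := by
    refine Module.End.eigenvectors_linearIndependent' (Matrix.toLin' M) l hl v fun j => ?_
    rw [Module.End.hasEigenvector_iff, Module.End.mem_eigenspace_iff]
    exact ⟨by rw [Matrix.toLin'_apply, hMv], hv0 j⟩
  have hu : IsUnit V := Matrix.linearIndependent_cols_iff_isUnit.1 hli
  have hu' : IsUnit V.det := (Matrix.isUnit_iff_isUnit_det _).1 hu
  refine ⟨V, V⁻¹, Matrix.mul_nonsing_inv _ hu', Matrix.nonsing_inv_mul _ hu', ?_⟩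
  have hMV : M * V = V * Matrix.diagonal l := by
    ext i j
    have := congrFun (hMv j) i
    rw [Matrix.mul_diagonal]
    simpa [Matrix.mul_apply, Matrix.mulVec, dotProduct, hV, mul_comm] using this
  rw [← hMV, mul_assoc, Matrix.mul_nonsing_inv _ hu', mul_one]

/-- With distinct eigenvalues each eigenspace is a line. -/
theorem eq_smul_of_mulVec_eq_smul {M V V' : Matrix n n ℂ} {l : n → ℂ}
    (hl : Function.Injective l) (hV : V * V' = 1) (hV' : V' * V = 1)
    (hM : M = V * Matrix.diagonal l * V') {j : n} {u : n → ℂ} (hu : M *ᵥ u = l j • u) :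
    ∃ c : ℂ, u = c • V.col j := by
  have h1 : Matrix.diagonal l *ᵥ (V' *ᵥ u) = l j • (V' *ᵥ u) := by
    rw [← Matrix.mulVec_smul, ← hu, hM, Matrix.mulVec_mulVec, Matrix.mulVec_mulVec, ← mul_assoc,
      ← mul_assoc, hV', one_mul]
  have h2 : V' *ᵥ u = Pi.single j ((V' *ᵥ u) j) := by
    ext k
    by_cases hk : k = j
    · subst hk; simp
    · have := congrFun h1 k
      rw [Matrix.mulVec_diagonal, Pi.smul_apply, smul_eq_mul] at this
      rw [Pi.single_eq_of_ne hk]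
      exact (mul_eq_mul_right_iff.1 this).resolve_left fun h => hk (hl h)
  refine ⟨(V' *ᵥ u) j, ?_⟩
  calc u = V *ᵥ (V' *ᵥ u) := by rw [Matrix.mulVec_mulVec, hV, Matrix.one_mulVec]
    _ = _ := by
      rw [h2, Matrix.mulVec_single]
      ext i
      simp [mul_comm]

theorem eq_single_of_diagonal_mulVec {w u : n → ℂ} (hw : Function.Injective w) (hu : u ≠ 0)
    {c : ℂ} (h : Matrix.diagonal w *ᵥ u = c • u) : ∃ k, u k ≠ 0 ∧ u = Pi.single k (u k) := by
  obtain ⟨k, hk⟩ := Function.ne_iff.1 hu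
  have hi : ∀ i, u i ≠ 0 → w i = c := by
    intro i hi
    have := congrFun h i
    rw [Matrix.mulVec_diagonal, Pi.smul_apply, smul_eq_mul] at this
    exact mul_right_cancel₀ hi this
  refine ⟨k, hk, ?_⟩
  ext i
  by_cases hik : i = k
  · subst hik; simp
  · rw [Pi.single_eq_of_ne hik]
    by_contra h0
    exact hik (hw ((hi i h0).trans (hi k hk).symm))

namespace LaxRelations

variable {M V V' : Matrix n n ℂ} {E : Matrix (Fin 2) n ℂ} {w l : n → ℂ}

theorem col_ne_zero (hV' : V' * V = 1) (j : n) : V.col j ≠ 0 := by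
  intro h
  have := congrFun (congrFun hV' j) j
  rw [Matrix.mul_apply, Matrix.one_apply_eq] at this
  have h0 : ∀ i, V i j = 0 := fun i => congrFun h i
  simp [h0] at this

theorem mulVec_col (hV' : V' * V = 1) (hM : M = V * Matrix.diagonal l * V') (j : n) :
    M *ᵥ V.col j = l j • V.col j := by
  have h : M * V = V * Matrix.diagonal l := by rw [hM, mul_assoc, hV', mul_one]
  ext i
  have := congrFun (congrFun h i) j
  rw [Matrix.mul_diagonal] at this
  simpa [Matrix.mul_apply, Matrix.mulVec, dotProduct, mul_comm] using this

/-- If `E v = 0`, the first relation gives `Mᴴ v = M v`, and then the second makes `W v` an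
eigenvector candidate for the same simple eigenvalue. So `v` is an eigenvector of `W`, hence a
multiple of a basis vector, and `E` would have a zero entry. -/
theorem halfSpin_ne_zero (h : LaxRelations M (Matrix.diagonal w) E) (hw : Function.Injective w)
    (hE : ∀ k, E 0 k ≠ 0) (hl : Function.Injective l) (hV : V * V' = 1) (hV' : V' * V = 1)
    (hM : M = V * Matrix.diagonal l * V') (j : n) : E *ᵥ V.col j ≠ 0 := by
  intro h0
  set v := V.col j with hv
  have hMv : M *ᵥ v = l j • v := mulVec_col hV' hM j
  have h1 : Mᴴ *ᵥ v = l j • v := by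
    have := congrArg (· *ᵥ v) h.sub_conj
    simp only [Matrix.sub_mulVec, Matrix.smul_mulVec, ← Matrix.mulVec_mulVec, h0,
      Matrix.mulVec_zero, smul_zero] at this
    rw [← hMv]
    exact (sub_eq_zero.1 this).symm
  have h2 : M *ᵥ (Matrix.diagonal w *ᵥ v) = l j • (Matrix.diagonal w *ᵥ v) := by
    have := congrArg (· *ᵥ v) h.mul_sub_conj
    simp only [Matrix.sub_mulVec, Matrix.smul_mulVec, ← Matrix.mulVec_mulVec, h0,
      Matrix.mulVec_zero, smul_zero, h1, Matrix.mulVec_smul] at this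
    exact sub_eq_zero.1 this
  obtain ⟨c, hc⟩ := eq_smul_of_mulVec_eq_smul hl hV hV' hM h2
  obtain ⟨k, hk, hs⟩ := eq_single_of_diagonal_mulVec hw (col_ne_zero hV' j) hc
  have := congrFun h0 0
  rw [hv, hs, Matrix.mulVec_single] at this
  simp only [Pi.zero_apply, Pi.smul_apply, Matrix.col_apply] at this
  exact mul_ne_zero (hE k) hk (by simpa using this)

/-- Pairing `M - Mᴴ = i EᴴE` with an eigenvector `v` gives `2 Im(l j) |v|² = |E v|²`. -/
theorem im_pos (h : LaxRelations M (Matrix.diagonal w) E) (hw : Function.Injective w)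
    (hE : ∀ k, E 0 k ≠ 0) (hl : Function.Injective l) (hV : V * V' = 1) (hV' : V' * V = 1)
    (hM : M = V * Matrix.diagonal l * V') (j : n) : 0 < (l j).im := by
  have hEv := h.halfSpin_ne_zero hw hE hl hV hV' hM j
  have hv0 := col_ne_zero hV' j
  have hMv : M *ᵥ V.col j = l j • V.col j := mulVec_col hV' hM j
  set v := V.col j
  obtain ⟨r, hr, hr'⟩ := exists_pos_star_dotProduct_self hv0
  obtain ⟨q, hq, hq'⟩ := exists_pos_star_dotProduct_self hEv
  have e := congrArg (fun A => star v ⬝ᵥ (A *ᵥ v)) h.sub_conj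
  simp only [Matrix.sub_mulVec, dotProduct_sub, Matrix.smul_mulVec, dotProduct_smul,
    ← Matrix.mulVec_mulVec, hMv] at e
  have e2 : star v ⬝ᵥ (Mᴴ *ᵥ v) = star (l j) * (star v ⬝ᵥ v) := by
    rw [Matrix.dotProduct_mulVec, ← Matrix.star_mulVec, hMv, star_smul, smul_dotProduct, smul_eq_mul]
  have e3 : star v ⬝ᵥ (Eᴴ *ᵥ (E *ᵥ v)) = q := by
    rw [Matrix.dotProduct_mulVec, ← Matrix.star_mulVec, hq']
  rw [e2, e3, hr'] at e
  have := congrArg Complex.im e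
  simp at this
  nlinarith

/-- The dual argument for left eigenvectors, based on `F E = W M - M W`: a vanishing half-spin would
make a row of `F` zero, which forces `w k = -1` and `w k = 1` at once. -/
theorem coHalfSpin_ne_zero (h : LaxRelations M (Matrix.diagonal w) E) (hw : Function.Injective w)
    (hE : ∀ a k, E a k ≠ 0) (hl : Function.Injective l) (hV : V * V' = 1) (hV' : V' * V = 1)
    (hM : M = V * Matrix.diagonal l * V') (j : n) :
    V'.row j ᵥ* coSpin (Matrix.diagonal w) E ≠ 0 := by
  intro h0
  set u := V'.row j with hu
  have hMT : Mᵀ = V'ᵀ * Matrix.diagonal l * Vᵀ := by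
    rw [hM]; simp [Matrix.transpose_mul, mul_assoc]
  have hT : V'ᵀ * Vᵀ = 1 := by rw [← Matrix.transpose_mul, hV, Matrix.transpose_one]
  have hT' : Vᵀ * V'ᵀ = 1 := by rw [← Matrix.transpose_mul, hV', Matrix.transpose_one]
  have hMu : u ᵥ* M = l j • u := by
    rw [← Matrix.mulVec_transpose]
    exact mulVec_col hT' hMT j
  have h2 : Mᵀ *ᵥ (Matrix.diagonal w *ᵥ u) = l j • (Matrix.diagonal w *ᵥ u) := by
    have := congrArg (u ᵥ* ·) h.coSpin_mul
    simp only [← Matrix.vecMul_vecMul, h0, Matrix.zero_vecMul, Matrix.vecMul_sub, hMu,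
      Matrix.smul_vecMul] at this
    have hd : Matrix.diagonal w *ᵥ u = u ᵥ* Matrix.diagonal w := by
      rw [← Matrix.mulVec_transpose, Matrix.diagonal_transpose]
    rw [hd, Matrix.mulVec_transpose]
    exact sub_eq_zero.1 this.symm
  obtain ⟨c, hc⟩ := eq_smul_of_mulVec_eq_smul hl hT hT' hMT h2
  obtain ⟨k, hk, hs⟩ := eq_single_of_diagonal_mulVec hw (col_ne_zero hT' j) hc
  change u k ≠ 0 at hk
  have hF : ∀ b, coSpin (Matrix.diagonal w) E k b = 0 := by
    intro b
    have := congrFun h0 b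
    have hs' : u = Pi.single k (u k) := hs
    rw [hs', Matrix.single_vecMul] at this
    have hp : u k * coSpin (Matrix.diagonal w) E k b = 0 := this
    exact (mul_eq_zero.1 hp).resolve_left hk
  have hF0 := hF 0
  have hF1 := hF 1
  simp only [coSpin, pauliZ, Matrix.smul_apply, Matrix.add_apply, Matrix.diagonal_mul,
    Matrix.mul_diagonal, Matrix.conjTranspose_apply, smul_eq_mul, mul_eq_zero, Complex.I_ne_zero,
    false_or] at hF0 hF1
  have n0 : star (E 0 k) ≠ 0 := by simpa using hE 0 k
  have n1 : star (E 1 k) ≠ 0 := by simpa using hE 1 k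
  have f0 : w k + 1 = 0 := by
    refine (mul_eq_zero.1 ?_).resolve_right n0
    simp only [Matrix.cons_val_zero, mul_one] at hF0
    linear_combination hF0
  have f1 : w k - 1 = 0 := by
    refine (mul_eq_zero.1 ?_).resolve_right n1
    simp only [Matrix.cons_val_one, Matrix.cons_val_fin_one, mul_neg, mul_one] at hF1
    linear_combination hF1
  have : (2 : ℂ) = 0 := by linear_combination f0 - f1
  norm_num at this

end LaxRelations

/-- First-order perturbation theory for a simple eigenvalue. -/
theorem eigenvalue_derivative {B W V V' : Matrix n n ℂ} {l : n → ℂ} (hl : Function.Injective l)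
    (hV' : V' * V = 1) {τ₀ : ℝ}
    (hM : B + (τ₀ : ℂ) • W = V * Matrix.diagonal l * V') {j : n} {f : ℝ → ℂ} {d : ℂ}
    (hf : HasDerivAt f d τ₀) (hf0 : f τ₀ = l j)
    (hdet : ∀ᶠ τ in 𝓝 τ₀, (f τ • (1 : Matrix n n ℂ) - (B + (τ : ℂ) • W)).det = 0) :
    d = (V' * W * V) j j := by
  set Y := V' * W * V with hY
  -- In the eigenbasis at `τ₀` the singular matrix `C τ` satisfies `C * adj C = 0`. Its `(j, j)`
  -- entry, divided by `τ - τ₀`, passes to the limit because `adj C` is continuous and `adj (C τ₀)`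
  -- is diagonal with nonzero `(j, j)` entry. No differentiable eigenvector is needed.
  set C : ℝ → Matrix n n ℂ := fun τ =>
    f τ • 1 - Matrix.diagonal l - ((τ : ℂ) - τ₀) • Y with hC
  have hCeq : ∀ τ, C τ = V' * (f τ • (1 : Matrix n n ℂ) - (B + (τ : ℂ) • W)) * V := by
    intro τ
    have h1 : B + (τ : ℂ) • W = V * Matrix.diagonal l * V' + ((τ : ℂ) - τ₀) • W := by
      rw [← hM, sub_smul]; abel
    rw [h1, hC, hY]
    have h2 : V' * (V * Matrix.diagonal l * V') * V = Matrix.diagonal l := by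
      rw [← mul_assoc, ← mul_assoc, hV', one_mul, mul_assoc, hV', mul_one]
    simp only [mul_sub, sub_mul, mul_add, add_mul, Matrix.mul_smul, Matrix.smul_mul, mul_one, hV', h2]
    abel
  have hCdet : ∀ᶠ τ in 𝓝 τ₀, (C τ).det = 0 := by
    filter_upwards [hdet] with τ hτ
    rw [hCeq, Matrix.det_mul, Matrix.det_mul, hτ]
    ring
  have hCcont : ContinuousAt C τ₀ := by
    have := hf.continuousAt
    fun_prop
  have hadj : ∀ i k, ContinuousAt (fun τ => (C τ).adjugate i k) τ₀ := by
    intro i k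
    have : ContinuousAt (fun τ => (C τ).adjugate) τ₀ :=
      (continuous_id.matrix_adjugate).continuousAt.comp hCcont
    exact ((continuous_apply k).comp (continuous_apply i)).continuousAt.comp this
  have hC0 : C τ₀ = Matrix.diagonal fun k => l j - l k := by
    rw [hC]
    simp only [sub_self, zero_smul, sub_zero, hf0]
    rw [← Matrix.diagonal_one, ← Matrix.diagonal_smul, Matrix.diagonal_sub]
    simp
  have hadj0 : (C τ₀).adjugate = Matrix.diagonal fun i => ∏ k ∈ Finset.univ.erase i, (l j - l k) := by
    rw [hC0, Matrix.adjugate_diagonal]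
  have hslope : ∀ᶠ τ in 𝓝[≠] τ₀, slope f τ₀ τ * (C τ).adjugate j j
      = ∑ k, Y j k * (C τ).adjugate k j := by
    filter_upwards [hCdet.filter_mono nhdsWithin_le_nhds, self_mem_nhdsWithin] with τ hτ hne
    have hne' : (τ : ℂ) - τ₀ ≠ 0 := by
      rw [sub_ne_zero]; exact_mod_cast hne
    have h1 := congrFun (congrFun (Matrix.mul_adjugate (C τ)) j) j
    rw [hτ, zero_smul, Matrix.zero_apply, Matrix.mul_apply] at h1
    have h2 : ∀ k, C τ j k * (C τ).adjugate k j = (if j = k then f τ - l j else 0) *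
        (C τ).adjugate k j - ((τ : ℂ) - τ₀) * (Y j k * (C τ).adjugate k j) := by
      intro k
      have : C τ j k = (if j = k then f τ - l j else 0) - ((τ : ℂ) - τ₀) * Y j k := by
        by_cases hjk : j = k
        · subst hjk; simp [hC]
        · simp [hC, hjk]
      rw [this]; ring
    simp only [h2, Finset.sum_sub_distrib, ← Finset.mul_sum, ite_mul, zero_mul, Finset.sum_ite_eq,
      Finset.mem_univ, if_true] at h1
    rw [slope_def_module, hf0, Complex.real_smul]
    push_cast
    field_simp
    linear_combination h1
  have hlim1 := (hasDerivAt_iff_tendsto_slope.1 hf).mul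
    ((hadj j j).tendsto.mono_left nhdsWithin_le_nhds)
  have hlim2 : Tendsto (fun τ => ∑ k, Y j k * (C τ).adjugate k j) (𝓝[≠] τ₀)
      (𝓝 (∑ k, Y j k * (C τ₀).adjugate k j)) :=
    tendsto_finsetSum _ fun k _ =>
      ((hadj k j).tendsto.mono_left nhdsWithin_le_nhds).const_mul _
  have heq := tendsto_nhds_unique (hlim1.congr' hslope) hlim2
  have hne : (C τ₀).adjugate j j ≠ 0 := by
    rw [hadj0, Matrix.diagonal_apply_eq, Finset.prod_ne_zero_iff]
    intro k hk
    rw [sub_ne_zero]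
    exact fun h => (Finset.ne_of_mem_erase hk) (hl h).symm
  rw [Finset.sum_eq_single j] at heq
  · exact mul_right_cancel₀ hne heq
  · intro k _ hk
    rw [hadj0, Matrix.diagonal_apply_ne _ hk, mul_zero]
  · simp

end Spectral

/-! ### Eigenvalues for large time -/

section Perturbation

variable {n : Type*} [Fintype n] [DecidableEq n]

/-- Implicit function theorem for the characteristic polynomial: at `s = 0` its derivative in `z` at
`w j` is `∏ (w j - w k)` over `k ≠ j`, nonzero since the `w k` are distinct. -/
theorem exists_eigenvalue_branch (B : Matrix n n ℂ) {w : n → ℂ} (hw : Function.Injective w)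
    (j : n) : ∃ g : ℂ → ℂ, ContDiffAt ℂ 1 g 0 ∧ g 0 = w j ∧
      ∀ᶠ s in 𝓝 (0 : ℂ), (g s • (1 : Matrix n n ℂ) - (Matrix.diagonal w + s • B)).det = 0 := by
  set f : ℂ × ℂ → ℂ := fun p => (p.2 • (1 : Matrix n n ℂ) - (Matrix.diagonal w + p.1 • B)).det
    with hf
  have hcd : ContDiff ℂ 1 f := by
    simp only [hf, Matrix.det_apply, Matrix.sub_apply, Matrix.add_apply, Matrix.smul_apply,
      smul_eq_mul]
    refine ContDiff.sum fun σ _ => ContDiff.const_smul _ (contDiff_prod fun i _ => ?_)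
    fun_prop
  have hf0 : ∀ z, f (0, z) = (z - w j) * ∏ k ∈ Finset.univ.erase j, (z - w k) := by
    intro z
    have : z • (1 : Matrix n n ℂ) - (Matrix.diagonal w + (0 : ℂ) • B)
        = Matrix.diagonal fun k => z - w k := by
      rw [zero_smul, add_zero, ← Matrix.diagonal_one, ← Matrix.diagonal_smul, Matrix.diagonal_sub]
      simp
    simp only [hf, this, Matrix.det_diagonal]
    rw [Finset.mul_prod_erase Finset.univ (fun k => z - w k) (Finset.mem_univ j)]
  set u : ℂ × ℂ := (0, w j) with hu
  have hfu : f u = 0 := by rw [hu, hf0]; simp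
  set q : ℂ := ∏ k ∈ Finset.univ.erase j, (w j - w k) with hq
  have hq0 : q ≠ 0 := by
    rw [hq, Finset.prod_ne_zero_iff]
    intro k hk
    rw [sub_ne_zero]
    exact fun h => (Finset.ne_of_mem_erase hk) (hw h).symm
  have hder : HasDerivAt (fun z => f (0, z)) q (w j) := by
    have hP : DifferentiableAt ℂ (fun z => ∏ k ∈ Finset.univ.erase j, (z - w k)) (w j) := by
      fun_prop
    have := ((hasDerivAt_id (w j)).sub_const (w j)).mul hP.hasDerivAt
    simp only [id, sub_self, zero_mul, add_zero, one_mul] at this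
    exact this.congr_of_eventuallyEq (Eventually.of_forall fun z => hf0 z)
  have hfd : HasFDerivAt f (fderiv ℂ f u) u :=
    (hcd.differentiable (by norm_num) u).hasFDerivAt
  have hinr : HasDerivAt (fun z => f (0, z)) ((fderiv ℂ f u ∘L .inr ℂ ℂ ℂ) 1) (w j) := by
    have h1 : HasFDerivAt (fun z : ℂ => ((0 : ℂ), z)) (.inr ℂ ℂ ℂ) (w j) :=
      hasFDerivAt_prodMk_right _ _
    exact (HasFDerivAt.comp (w j) hfd h1).hasDerivAt
  have hone : (fderiv ℂ f u ∘L .inr ℂ ℂ ℂ) 1 = q := hinr.unique hder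
  have hinv : (fderiv ℂ f u ∘L .inr ℂ ℂ ℂ).IsInvertible := by
    refine ContinuousLinearMap.IsInvertible.of_inverse
      (g := q⁻¹ • ContinuousLinearMap.id ℂ ℂ) ?_ ?_
    · ext
      rw [ContinuousLinearMap.comp_apply, smul_apply, map_smul]
      simp only [ContinuousLinearMap.id_apply, hone, smul_eq_mul]
      exact inv_mul_cancel₀ hq0
    · ext
      rw [ContinuousLinearMap.comp_apply, hone]
      simp [hq0]
  refine ⟨hcd.contDiffAt.implicitFunction one_ne_zero hinv,
    hcd.contDiffAt.contDiffAt_implicitFunction one_ne_zero hinv,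
    hcd.contDiffAt.implicitFunction_apply_self one_ne_zero hinv, ?_⟩
  filter_upwards [hcd.contDiffAt.eventually_apply_implicitFunction one_ne_zero hinv] with s hs
  rw [hfu] at hs
  exact hs

/-- The eigenvalues of `B + τ diag w` for large `τ`. -/
theorem exists_eigenvalues_add_smul_diagonal (B : Matrix n n ℂ) {w : n → ℂ}
    (hw : Function.Injective w) {ε : ℝ} (hε : 0 < ε) :
    ∃ (K : ℝ) (l l' : ℝ → n → ℂ), ∀ τ, K < τ → Function.Injective (l τ) ∧ ∀ j,
      HasDerivAt (fun σ => l σ j) (l' τ j) τ ∧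
      (l τ j • (1 : Matrix n n ℂ) - (B + (τ : ℂ) • Matrix.diagonal w)).det = 0 ∧
      ‖l' τ j - w j‖ ≤ ε := by
  choose g hg hg0 hgdet using exists_eigenvalue_branch B hw
  have hlim : Tendsto (fun τ : ℝ => ((τ : ℂ))⁻¹) atTop (𝓝 0) := by
    have := (Complex.continuous_ofReal.tendsto 0).comp tendsto_inv_atTop_zero
    simpa [Function.comp_def] using this
  have hev : ∀ᶠ s in 𝓝 (0 : ℂ), (∀ j k, j ≠ k → g j s ≠ g k s) ∧ ∀ j,
      DifferentiableAt ℂ (g j) s ∧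
      (g j s • (1 : Matrix n n ℂ) - (Matrix.diagonal w + s • B)).det = 0 ∧
      ‖g j s - s * deriv (g j) s - w j‖ ≤ ε := by
    refine Eventually.and ?_ ?_
    · rw [eventually_all]; intro j
      rw [eventually_all]; intro k
      by_cases hjk : j = k
      · simp [hjk]
      · have : g j 0 ≠ g k 0 := by
          rw [hg0, hg0]; exact fun h => hjk (hw h)
        filter_upwards [((hg j).continuousAt.sub (hg k).continuousAt).eventually_ne
          (sub_ne_zero.2 this)] with s hs _
        exact sub_ne_zero.1 hs
    · rw [eventually_all]; intro j
      refine Eventually.and ?_ (Eventually.and (hgdet j) ?_)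
      · filter_upwards [(hg j).eventually (by norm_num)] with s hs
        exact hs.differentiableAt (by norm_num)
      -- Continuity of `g'` is what makes `s g'(s)` tend to zero; differentiability of the branch
      -- would not suffice.
      · have hd : ContinuousAt (deriv (g j)) 0 := by
          have h1 : ContDiffAt ℂ 0 (fderiv ℂ (g j)) 0 := (hg j).fderiv_right (by norm_num)
          have h2 := h1.continuousAt
          exact h2.clm_apply continuousAt_const
        have hc : ContinuousAt (fun s => ‖g j s - s * deriv (g j) s - w j‖) 0 := by
          have := (hg j).continuousAt
          fun_prop
        have h0 : ‖g j 0 - 0 * deriv (g j) 0 - w j‖ < ε := by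
          rw [hg0]; simpa using hε
        filter_upwards [hc.eventually_lt continuousAt_const h0] with s hs
        exact hs.le
  obtain ⟨K, hK⟩ := eventually_atTop.1 (hlim.eventually hev)
  -- With `s = τ⁻¹`, `B + τ W = τ (W + s B)` has the eigenvalues `τ g(s)`, whose `τ`-derivative is
  -- `g(s) - s g'(s)`.
  refine ⟨max K 0, fun τ j => (τ : ℂ) * g j (τ : ℂ)⁻¹,
    fun τ j => g j (τ : ℂ)⁻¹ - (τ : ℂ)⁻¹ * deriv (g j) (τ : ℂ)⁻¹, fun τ hτ => ?_⟩
  have hτK : K ≤ τ := (le_max_left _ _).trans hτ.le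
  have hτ0 : 0 < τ := lt_of_le_of_lt (le_max_right _ _) hτ
  have hτ' : (τ : ℂ) ≠ 0 := by exact_mod_cast hτ0.ne'
  obtain ⟨hinj, hj⟩ := hK τ hτK
  refine ⟨fun j k hjk => ?_, fun j => ⟨?_, ?_, (hj j).2.2⟩⟩
  · by_contra hne
    exact hinj j k hne (mul_left_cancel₀ hτ' hjk)
  · have h1 : HasDerivAt (fun z : ℂ => z⁻¹) (-((τ : ℂ) ^ 2)⁻¹) (τ : ℂ) := hasDerivAt_inv hτ'
    have h2 := HasDerivAt.comp (τ : ℂ) (hj j).1.hasDerivAt h1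
    have h3 := ((hasDerivAt_id (τ : ℂ)).mul h2).comp_ofReal
    refine h3.congr_deriv ?_
    simp only [id, Function.comp_apply]
    field_simp
    ring
  · have h1 : ((τ : ℂ) * g j (τ : ℂ)⁻¹) • (1 : Matrix n n ℂ) - (B + (τ : ℂ) • Matrix.diagonal w)
        = (τ : ℂ) • (g j (τ : ℂ)⁻¹ • (1 : Matrix n n ℂ) - (Matrix.diagonal w + (τ : ℂ)⁻¹ • B)) := by
      rw [smul_sub, smul_add, smul_smul, smul_smul, mul_inv_cancel₀ hτ', one_smul, add_comm B]
    rw [h1, Matrix.det_smul, (hj j).2.1, mul_zero]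

end Perturbation

/-! ### The wave map, its derivatives and its equation -/

section Wave

variable {n : Type*} [Fintype n] [DecidableEq n]

/-- The resolvent identity gives the difference quotient in closed form. It serves twice: `Q = 1`
for the space derivative, `Q = -W` for the time derivative. -/
theorem hasDerivAt_inv_affine (P Q : Matrix n n ℂ) {σ₀ : ℝ}
    (h : IsUnit (P + (σ₀ : ℂ) • Q).det) (φ : Matrix n n ℂ →ₗ[ℂ] ℂ) :
    HasDerivAt (fun σ : ℝ => φ (P + (σ : ℂ) • Q)⁻¹)
      (-φ ((P + (σ₀ : ℂ) • Q)⁻¹ * Q * (P + (σ₀ : ℂ) • Q)⁻¹)) σ₀ := by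
  set D : ℝ → Matrix n n ℂ := fun σ => P + (σ : ℂ) • Q with hD
  have hDc : Continuous D := by fun_prop
  have hdet : ∀ᶠ σ in 𝓝 σ₀, (D σ).det ≠ 0 :=
    hDc.matrix_det.continuousAt.eventually_ne h.ne_zero
  have hinv : ContinuousAt (fun σ => (D σ)⁻¹) σ₀ := by
    have : (fun σ => (D σ)⁻¹) = fun σ => ((D σ).det)⁻¹ • (D σ).adjugate := by
      funext σ
      rw [Matrix.inv_def, Ring.inverse_eq_inv']
    rw [this]
    exact (hDc.matrix_det.continuousAt.inv₀ h.ne_zero).smul hDc.matrix_adjugate.continuousAt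
  have hφ : Continuous φ := φ.continuous_of_finiteDimensional
  rw [hasDerivAt_iff_tendsto_slope]
  have hlim : Tendsto (fun σ => φ (-((D σ)⁻¹ * Q * (D σ₀)⁻¹))) (𝓝[≠] σ₀)
      (𝓝 (φ (-((D σ₀)⁻¹ * Q * (D σ₀)⁻¹)))) := by
    have hc : ContinuousAt (fun σ => φ (-((D σ)⁻¹ * Q * (D σ₀)⁻¹))) σ₀ :=
      hφ.continuousAt.comp (((hinv.mul continuousAt_const).mul continuousAt_const).neg)
    exact hc.tendsto.mono_left nhdsWithin_le_nhds
  rw [map_neg] at hlim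
  refine hlim.congr' ?_
  filter_upwards [hdet.filter_mono nhdsWithin_le_nhds, self_mem_nhdsWithin] with σ hσ hne
  have hne' : (σ : ℂ) - σ₀ ≠ 0 := by
    rw [sub_ne_zero]; exact_mod_cast hne
  have hres : (D σ)⁻¹ - (D σ₀)⁻¹ = ((σ : ℂ) - σ₀) • -((D σ)⁻¹ * Q * (D σ₀)⁻¹) := by
    have h1 : D σ₀ - D σ = -(((σ : ℂ) - σ₀) • Q) := by
      simp only [hD, sub_smul]; abel
    calc (D σ)⁻¹ - (D σ₀)⁻¹ = (D σ)⁻¹ * (D σ₀ - D σ) * (D σ₀)⁻¹ := by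
          rw [mul_sub, sub_mul, Matrix.nonsing_inv_mul _ (isUnit_iff_ne_zero.2 hσ), one_mul,
            mul_assoc, Matrix.mul_nonsing_inv _ h, mul_one]
      _ = _ := by
          rw [h1]; simp
  rw [slope_def_module, ← map_sub, hres, map_smul, Complex.real_smul, smul_eq_mul, ← mul_assoc]
  push_cast
  rw [inv_mul_cancel₀ hne', one_mul]

/-- The `i`-th Pauli coordinate of `E R F`, as a linear function of `R`. -/
noncomputable def sandwichCoord (E : Matrix (Fin 2) n ℂ) (F : Matrix n (Fin 2) ℂ) (i : Fin 3) :
    Matrix n n ℂ →ₗ[ℂ] ℂ where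
  toFun R := pauliCoord (E * R * F) i
  map_add' R S := by simp [Matrix.mul_add, Matrix.add_mul]
  map_smul' c R := by simp

/-- The spin with half-spins the `j`-th column of `E V` and the `j`-th row of `V' F`. -/
noncomputable def spinOf (E : Matrix (Fin 2) n ℂ) (F : Matrix n (Fin 2) ℂ) (V V' : Matrix n n ℂ)
    (j : n) : Fin 3 → ℂ :=
  pauliCoord (Matrix.of fun a b => (E * V) a j * (V' * F) j b)

theorem sandwichCoord_diagonal (E : Matrix (Fin 2) n ℂ) (F : Matrix n (Fin 2) ℂ)
    (V V' : Matrix n n ℂ) (d : n → ℂ) (i : Fin 3) :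
    sandwichCoord E F i (V * Matrix.diagonal d * V') = ∑ j, spinOf E F V V' j i * d j := by
  have h : E * (V * Matrix.diagonal d * V') * F
      = ∑ j, d j • Matrix.of fun a b => (E * V) a j * (V' * F) j b := by
    have : E * (V * Matrix.diagonal d * V') * F = (E * V) * Matrix.diagonal d * (V' * F) := by
      simp only [Matrix.mul_assoc]
    rw [this]
    ext a b
    rw [Matrix.mul_apply, Matrix.sum_apply]
    refine Finset.sum_congr rfl fun j _ => ?_
    rw [Matrix.mul_diagonal, Matrix.smul_apply, Matrix.of_apply, smul_eq_mul]
    ring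
  change pauliCoord _ i = _
  rw [h, map_sum, Finset.sum_apply]
  refine Finset.sum_congr rfl fun j _ => ?_
  rw [map_smul, Pi.smul_apply, smul_eq_mul, spinOf, mul_comm]

theorem resolvent_diagonalization {M V V' : Matrix n n ℂ} {l : n → ℂ} (hV : V * V' = 1)
    (hV' : V' * V = 1) (hM : M = V * Matrix.diagonal l * V') (hl : ∀ j, 0 < (l j).im) (y : ℝ) :
    IsUnit ((y : ℂ) • (1 : Matrix n n ℂ) - M).det ∧
    ((y : ℂ) • (1 : Matrix n n ℂ) - M)⁻¹ = V * Matrix.diagonal (fun j => ((y : ℂ) - l j)⁻¹) * V' := by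
  have h1 : (y : ℂ) • (1 : Matrix n n ℂ) - M = V * Matrix.diagonal (fun j => (y : ℂ) - l j) * V' := by
    have : Matrix.diagonal (fun j => (y : ℂ) - l j) = (y : ℂ) • (1 : Matrix n n ℂ) - Matrix.diagonal l := by
      rw [← Matrix.diagonal_one, ← Matrix.diagonal_smul, Matrix.diagonal_sub]
      simp
    rw [this, mul_sub, sub_mul, hM, Matrix.mul_smul, mul_one, Matrix.smul_mul, hV]
  have h2 : ((y : ℂ) • (1 : Matrix n n ℂ) - M)
      * (V * Matrix.diagonal (fun j => ((y : ℂ) - l j)⁻¹) * V') = 1 := by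
    have h3 : Matrix.diagonal (fun j => (y : ℂ) - l j) * Matrix.diagonal (fun j => ((y : ℂ) - l j)⁻¹)
        = 1 := by
      rw [Matrix.diagonal_mul_diagonal, ← Matrix.diagonal_one]
      congr 1
      funext j
      exact mul_inv_cancel₀ (ofReal_sub_ne_zero (hl j).ne' y)
    calc _ = V * Matrix.diagonal (fun j => (y : ℂ) - l j) * (V' * V)
          * Matrix.diagonal (fun j => ((y : ℂ) - l j)⁻¹) * V' := by rw [h1]; simp only [mul_assoc]
      _ = _ := by rw [hV', mul_one, mul_assoc V, h3, mul_one, hV]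
  exact ⟨(Matrix.isUnit_iff_isUnit_det _).1 (IsUnit.of_mul_eq_one _ h2), Matrix.inv_eq_right_inv h2⟩

/-- The map `m` with `m · σ = diag(1, -1) + A + Aᴴ`, `A = E (y - M)⁻¹ F`. -/
noncomputable def waveMap (M W : Matrix n n ℂ) (E : Matrix (Fin 2) n ℂ) (y : ℝ) (i : Fin 3) : ℝ :=
  ![0, 0, 1] i + 2 * (sandwichCoord E (coSpin W E) i ((y : ℂ) • (1 : Matrix n n ℂ) - M)⁻¹).re

theorem ofReal_two_mul_re_pauliCoord (S : Matrix (Fin 2) (Fin 2) ℂ) (i : Fin 3) :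
    ((2 * (pauliCoord S i).re : ℝ) : ℂ) = pauliCoord (S + Sᴴ) i := by
  rw [map_add, Pi.add_apply, pauliCoord_conjTranspose, Complex.add_conj]

theorem ofReal_waveMap (M W : Matrix n n ℂ) (E : Matrix (Fin 2) n ℂ) (y : ℝ) :
    (fun i => (waveMap M W E y i : ℂ)) = pauliCoord (pauliZ
      + E * ((y : ℂ) • (1 : Matrix n n ℂ) - M)⁻¹ * coSpin W E
      + (E * ((y : ℂ) • (1 : Matrix n n ℂ) - M)⁻¹ * coSpin W E)ᴴ) := by
  funext i
  have h0 : (((![0, 0, 1] : Fin 3 → ℝ) i : ℝ) : ℂ) = pauliCoord pauliZ i := by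
    fin_cases i <;> simp [pauliCoord, pauliZ]
  rw [add_assoc, map_add, Pi.add_apply, ← ofReal_two_mul_re_pauliCoord, ← h0, ← Complex.ofReal_add]
  rfl

theorem ofReal_cross (a b : Fin 3 → ℝ) :
    (fun i => ((a ⨯₃ b) i : ℂ)) = (fun i => (a i : ℂ)) ⨯₃ (fun i => (b i : ℂ)) := by
  funext i
  fin_cases i <;> simp [cross_apply]

namespace LaxRelations

variable {M W : Matrix n n ℂ} {E : Matrix (Fin 2) n ℂ} {y : ℝ}

theorem trace_add_conjTranspose (h : LaxRelations M W E)
    (hu : IsUnit ((y : ℂ) • (1 : Matrix n n ℂ) - M).det) :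
    (pauliZ + E * ((y : ℂ) • (1 : Matrix n n ℂ) - M)⁻¹ * coSpin W E
      + (E * ((y : ℂ) • (1 : Matrix n n ℂ) - M)⁻¹ * coSpin W E)ᴴ).trace = 0 := by
  have := h.trace_eq_zero_of_comm
    (resolvent_comm (Matrix.nonsing_inv_mul _ hu) (Matrix.mul_nonsing_inv _ hu))
  rw [Matrix.trace_add, Matrix.trace_add, Matrix.trace_conjTranspose, this, pauliZ_trace]
  simp

theorem waveMap_dotProduct_self (h : LaxRelations M W E)
    (hu : IsUnit ((y : ℂ) • (1 : Matrix n n ℂ) - M).det) :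
    waveMap M W E y ⬝ᵥ waveMap M W E y = 1 := by
  have h1 := h.mul_self_eq_one (Matrix.nonsing_inv_mul _ hu) (Matrix.mul_nonsing_inv _ hu)
  have h2 := pauliMatrix_pauliCoord (h.trace_add_conjTranspose hu)
  rw [← ofReal_waveMap] at h2
  rw [← h2] at h1
  have h3 := dotProduct_self_eq_one_of_pauliMatrix_mul_self h1
  have : ((waveMap M W E y ⬝ᵥ waveMap M W E y : ℝ) : ℂ) = 1 := by
    rw [← h3]; simp [dotProduct]
  exact_mod_cast this

/-- This is `evolution` in coordinates: the left side is `∂ₜ m`, and the second factor of the cross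
product is `H (∂ₓ m)`. -/
theorem waveMap_cross (h : LaxRelations M W E)
    (hu : IsUnit ((y : ℂ) • (1 : Matrix n n ℂ) - M).det) {R : Matrix n n ℂ}
    (hR : R = ((y : ℂ) • (1 : Matrix n n ℂ) - M)⁻¹) (i : Fin 3) :
    2 * (sandwichCoord E (coSpin W E) i (R * W * R)).re = (waveMap M W E y ⨯₃ fun k =>
      2 * (Complex.I * sandwichCoord E (coSpin W E) k (-(R * R))).re) i := by
  have hR1 : R * ((y : ℂ) • 1 - M) = 1 := hR ▸ Matrix.nonsing_inv_mul _ hu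
  have hR2 : ((y : ℂ) • 1 - M) * R = 1 := hR ▸ Matrix.mul_nonsing_inv _ hu
  set F := coSpin W E with hF
  set A := E * R * F with hA
  set Ax := -(E * (R * R) * F) with hAx
  set At := E * (R * W * R) * F with hAt
  have hcomm := resolvent_comm hR1 hR2
  have hm : (fun i => (waveMap M W E y i : ℂ)) = pauliCoord (pauliZ + A + Aᴴ) := by
    rw [ofReal_waveMap, ← hR]
  have htr : (pauliZ + A + Aᴴ).trace = 0 := by
    have := h.trace_add_conjTranspose hu
    rwa [← hR] at this
  have htrx : Ax.trace = 0 := by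
    have := h.trace_eq_zero_of_comm (R := R * R)
      (by rw [mul_assoc, hcomm, ← mul_assoc, hcomm, mul_assoc])
    rw [hAx, Matrix.trace_neg, this, neg_zero]
  -- The Hilbert transform acts as `i` on `Ax` and as `-i` on its adjoint. This `i` cancels the
  -- `-i/2` of `pauliMatrix_cross`, up to the factor `1/2` absorbed by `evolution`.
  have hh : (fun k => ((2 * (Complex.I * sandwichCoord E F k (-(R * R))).re : ℝ) : ℂ))
      = pauliCoord (Complex.I • (Ax - Axᴴ)) := by
    funext k
    have e1 : Complex.I * sandwichCoord E F k (-(R * R)) = pauliCoord (Complex.I • Ax) k := by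
      rw [map_smul, Pi.smul_apply, smul_eq_mul, hAx, map_neg, map_neg]
      rfl
    rw [e1, ofReal_two_mul_re_pauliCoord, Matrix.conjTranspose_smul, smul_sub, sub_eq_add_neg]
    simp
  have hev := h.evolution hR1 hR2 hA rfl hAx hAt
  have key : pauliMatrix ((fun i => (waveMap M W E y i : ℂ)) ⨯₃
      (fun k => ((2 * (Complex.I * sandwichCoord E F k (-(R * R))).re : ℝ) : ℂ))) = At + Atᴴ := by
    rw [pauliMatrix_cross, hm, hh, pauliMatrix_pauliCoord htr, pauliMatrix_pauliCoord
      (by rw [Matrix.trace_smul, Matrix.trace_sub, Matrix.trace_conjTranspose, htrx]; simp),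
      Matrix.mul_smul, Matrix.smul_mul, ← smul_sub, hev, smul_smul, smul_smul]
    have : -Complex.I / 2 * (Complex.I * 2) = 1 := by
      linear_combination -Complex.I_sq
    rw [mul_assoc, this, one_smul]
  have h1 := congrFun (congrArg pauliCoord key) i
  rw [pauliCoord_pauliMatrix, ← ofReal_cross, ← ofReal_two_mul_re_pauliCoord] at h1
  exact Complex.ofReal_injective h1.symm

end LaxRelations

theorem hasDerivAt_waveMap {M : Matrix n n ℂ} (W : Matrix n n ℂ) (E : Matrix (Fin 2) n ℂ) {y : ℝ}
    (hu : IsUnit ((y : ℂ) • (1 : Matrix n n ℂ) - M).det) :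
    HasDerivAt (waveMap M W E) (fun i => 2 * (sandwichCoord E (coSpin W E) i
      (-(((y : ℂ) • (1 : Matrix n n ℂ) - M)⁻¹ * ((y : ℂ) • (1 : Matrix n n ℂ) - M)⁻¹))).re) y := by
  rw [hasDerivAt_pi]
  intro i
  have e : ∀ σ : ℝ, (σ : ℂ) • (1 : Matrix n n ℂ) - M = -M + (σ : ℂ) • 1 := fun σ => by abel
  simp only [waveMap, e] at hu ⊢
  have h1 := hasDerivAt_inv_affine (-M) 1 hu (sandwichCoord E (coSpin W E) i)
  have h2 := (Complex.reCLM.hasFDerivAt.comp_hasDerivAt y h1).const_mul 2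
  refine (h2.const_add _).congr_deriv ?_
  rw [mul_one, ← map_neg (sandwichCoord E (coSpin W E) i)]
  rfl

theorem hasDerivAt_waveMap_time (B W : Matrix n n ℂ) (E : Matrix (Fin 2) n ℂ) (y : ℝ) {T t : ℝ}
    {R : Matrix n n ℂ}
    (hR : R = ((y : ℂ) • (1 : Matrix n n ℂ) - (B + ((T + t : ℝ) : ℂ) • W))⁻¹)
    (hu : IsUnit ((y : ℂ) • (1 : Matrix n n ℂ) - (B + ((T + t : ℝ) : ℂ) • W)).det) :
    HasDerivAt (fun τ : ℝ => waveMap (B + ((T + τ : ℝ) : ℂ) • W) W E y)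
      (fun i => 2 * (sandwichCoord E (coSpin W E) i (R * W * R)).re) t := by
  rw [hasDerivAt_pi]
  intro i
  have e : ∀ σ : ℝ, (y : ℂ) • (1 : Matrix n n ℂ) - (B + ((T + σ : ℝ) : ℂ) • W)
      = ((y : ℂ) • 1 - B - (T : ℂ) • W) + (σ : ℂ) • (-W) := fun σ => by
    push_cast
    rw [add_smul, smul_neg]; abel
  simp only [waveMap, e] at hu hR ⊢
  have h1 := hasDerivAt_inv_affine _ (-W) hu (sandwichCoord E (coSpin W E) i)
  have h2 := (Complex.reCLM.hasFDerivAt.comp_hasDerivAt t h1).const_mul 2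
  refine (h2.const_add _).congr_deriv ?_
  rw [← hR, mul_neg, neg_mul, ← map_neg (sandwichCoord E (coSpin W E) i), neg_neg]
  rfl

theorem isHilbertTransformAt_deriv_waveMap {M V V' : Matrix n n ℂ} (W : Matrix n n ℂ)
    (E : Matrix (Fin 2) n ℂ) {l : n → ℂ} (hV : V * V' = 1) (hV' : V' * V = 1)
    (hM : M = V * Matrix.diagonal l * V') (hl : ∀ j, 0 < (l j).im) (x : ℝ) (i : Fin 3) :
    IsHilbertTransformAt (fun y => deriv (waveMap M W E) y i) x
      (2 * (Complex.I * sandwichCoord E (coSpin W E) i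
      (-(((x : ℂ) • (1 : Matrix n n ℂ) - M)⁻¹ * ((x : ℂ) • (1 : Matrix n n ℂ) - M)⁻¹))).re) := by
  have hres := resolvent_diagonalization hV hV' hM hl
  have hsq : ∀ y : ℝ, 2 * sandwichCoord E (coSpin W E) i
      (-(((y : ℂ) • (1 : Matrix n n ℂ) - M)⁻¹ * ((y : ℂ) • (1 : Matrix n n ℂ) - M)⁻¹))
      = ∑ j, (-2 * spinOf E (coSpin W E) V V' j i) * (((y : ℂ) - l j) ^ 2)⁻¹ := by
    intro y
    have h1 : V * Matrix.diagonal (fun j => ((y : ℂ) - l j)⁻¹) * V'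
        * (V * Matrix.diagonal (fun j => ((y : ℂ) - l j)⁻¹) * V')
        = V * Matrix.diagonal (fun j => (((y : ℂ) - l j) ^ 2)⁻¹) * V' := by
      calc _ = V * Matrix.diagonal (fun j => ((y : ℂ) - l j)⁻¹) * (V' * V)
            * Matrix.diagonal (fun j => ((y : ℂ) - l j)⁻¹) * V' := by simp only [mul_assoc]
        _ = _ := by
          rw [hV', mul_one, mul_assoc V, Matrix.diagonal_mul_diagonal]
          simp only [pow_two, mul_inv]
    rw [(hres y).2, h1, map_neg, sandwichCoord_diagonal, mul_neg, ← neg_mul, Finset.mul_sum]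
    exact Finset.sum_congr rfl fun j _ => by ring
  have hmain := isHilbertTransformAt_re_sum (fun j => -2 * spinOf E (coSpin W E) V V' j i) l hl x
  simp only [← hsq] at hmain
  have e1 : ∀ y : ℝ, deriv (waveMap M W E) y i = (2 * sandwichCoord E (coSpin W E) i
      (-(((y : ℂ) • (1 : Matrix n n ℂ) - M)⁻¹ * ((y : ℂ) • (1 : Matrix n n ℂ) - M)⁻¹))).re := by
    intro y
    rw [(hasDerivAt_waveMap W E (hres y).1).deriv]
    simp
  simp only [e1]
  convert hmain using 1
  simp

end Wave

/-! ### Spins and the Lax matrix -/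

section Spins

namespace LaxRelations

variable {n : Type*} [Fintype n] [DecidableEq n] {M W V V' : Matrix n n ℂ}
  {E : Matrix (Fin 2) n ℂ} {l : n → ℂ}

/-- In the eigenbasis, the commutator `F E = W M - M W` becomes entries of `V' W V` times eigenvalue
differences. Dividing for `j ≠ k` yields the off-diagonal Lax matrix; `j = k` says that the rank-one
spin matrix is traceless. -/
theorem halfSpin_dotProduct (h : LaxRelations M W E) (hV' : V' * V = 1)
    (hM : M = V * Matrix.diagonal l * V') (j k : n) :
    (fun a => (E * V) a j) ⬝ᵥ (fun b => (V' * coSpin W E) k b)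
      = (l j - l k) * (V' * W * V) k j := by
  have h1 : (V' * coSpin W E) * (E * V)
      = V' * W * V * Matrix.diagonal l - Matrix.diagonal l * (V' * W * V) := by
    calc (V' * coSpin W E) * (E * V) = V' * (coSpin W E * E) * V := by simp only [Matrix.mul_assoc]
      _ = V' * W * V * Matrix.diagonal l * (V' * V)
          - (V' * V) * Matrix.diagonal l * (V' * W * V) := by
        rw [h.coSpin_mul, hM]; noncomm_ring
      _ = _ := by rw [hV', mul_one, one_mul]
  have h2 := congrFun (congrFun h1 k) j
  rw [Matrix.sub_apply, Matrix.mul_diagonal, Matrix.diagonal_mul, Matrix.mul_apply] at h2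
  rw [dotProduct]
  simp only [mul_comm ((E * V) _ j)]
  rw [h2]
  ring

theorem pauliMatrix_spinOf (h : LaxRelations M W E) (hV' : V' * V = 1)
    (hM : M = V * Matrix.diagonal l * V') (j : n) :
    pauliMatrix (spinOf E (coSpin W E) V V' j)
      = Matrix.of fun a b => (E * V) a j * (V' * coSpin W E) j b := by
  refine pauliMatrix_pauliCoord ?_
  have := h.halfSpin_dotProduct hV' hM j j
  rw [sub_self, zero_mul] at this
  exact this

theorem spinOf_ne_zero (h : LaxRelations M W E) (hV' : V' * V = 1)
    (hM : M = V * Matrix.diagonal l * V') (j : n) (he : E *ᵥ V.col j ≠ 0)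
    (hξ : V'.row j ᵥ* coSpin W E ≠ 0) : spinOf E (coSpin W E) V V' j ≠ 0 := by
  intro h0
  have h1 := h.pauliMatrix_spinOf hV' hM j
  rw [h0] at h1
  obtain ⟨a, ha⟩ := Function.ne_iff.1 he
  obtain ⟨b, hb⟩ := Function.ne_iff.1 hξ
  have h2 := congrFun (congrFun h1 a) b
  rw [Matrix.of_apply] at h2
  refine mul_ne_zero ha hb (h2.symm.trans ?_)
  fin_cases a <;> fin_cases b <;> simp [pauliMatrix]

end LaxRelations

/-- Half-spins and spectrum of a diagonalized configuration. -/
theorem LaxRelations.isSpectrum {N : ℕ} {M V V' : Matrix (Fin N) (Fin N) ℂ}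
    {E : Matrix (Fin 2) (Fin N) ℂ} {w l l' : Fin N → ℂ}
    (h : LaxRelations M (Matrix.diagonal w) E) (hV : V * V' = 1) (hV' : V' * V = 1)
    (hl : Function.Injective l) (hM : M = V * Matrix.diagonal l * V')
    (hl' : ∀ j, l' j = (V' * Matrix.diagonal w * V) j j) :
    IsSpectrum (spinOf E (coSpin (Matrix.diagonal w) E) V V') l l' w := by
  set F := coSpin (Matrix.diagonal w) E with hF
  refine ⟨fun j a => (E * V) a j, fun j b => (V' * F) j b, fun j => ?_, ?_⟩
  · rw [h.pauliMatrix_spinOf hV' hM j]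
    ext a b
    rw [Matrix.mul_diagonal, Matrix.diagonal_mul]
    simp [hF]
  · have hlax : laxMatrix l l' (fun j a => (E * V) a j) (fun j b => (V' * F) j b)
        = (V' * Matrix.diagonal w * V)ᵀ := by
      ext j k
      rw [laxMatrix, Matrix.of_apply, Matrix.transpose_apply]
      split_ifs with hjk
      · rw [← hjk, hl']
      · rw [h.halfSpin_dotProduct hV' hM j k]
        exact mul_div_cancel_left₀ _ (sub_ne_zero.2 fun e => hjk (hl e))
    rw [hlax, Matrix.charpoly_transpose, mul_assoc, Matrix.charpoly_mul_comm, mul_assoc, hV, mul_one,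
      Matrix.charpoly_diagonal]

end Spins

/-! ### Initial data -/

section Data

/-- The half-spins `(√(1 - wⱼ), √(1 + wⱼ))` of the asymptotic solitons. -/
noncomputable def asymptoticHalfSpins {n : Type*} (w : n → ℝ) : Matrix (Fin 2) n ℂ :=
  Matrix.of ![fun j => ((√(1 - w j) : ℝ) : ℂ), fun j => ((√(1 + w j) : ℝ) : ℂ)]

theorem asymptoticHalfSpins_ne_zero {n : Type*} {w : n → ℝ} (hw : ∀ j, |w j| < 1) (a : Fin 2)
    (k : n) : asymptoticHalfSpins w a k ≠ 0 := by
  have h := abs_lt.1 (hw k)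
  fin_cases a
  · simp only [asymptoticHalfSpins, Matrix.of_apply]
    exact Complex.ofReal_ne_zero.2 (Real.sqrt_pos.2 (by linarith)).ne'
  · simp only [asymptoticHalfSpins, Matrix.of_apply]
    exact Complex.ofReal_ne_zero.2 (Real.sqrt_pos.2 (by linarith)).ne'

theorem exists_laxRelations {n : Type*} [Fintype n] [DecidableEq n] {w : n → ℝ}
    (hinj : Function.Injective w) (hw : ∀ j, |w j| < 1) :
    ∃ B : Matrix n n ℂ,
      LaxRelations B (Matrix.diagonal fun j => (w j : ℂ)) (asymptoticHalfSpins w) := by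
  set a : n → ℝ := fun j => √(1 - w j) with ha
  set b : n → ℝ := fun j => √(1 + w j) with hb
  have ha2 : ∀ j, a j * a j = 1 - w j := fun j =>
    Real.mul_self_sqrt (by have := abs_lt.1 (hw j); linarith)
  have hb2 : ∀ j, b j * b j = 1 + w j := fun j =>
    Real.mul_self_sqrt (by have := abs_lt.1 (hw j); linarith)
  -- With `B = i r`, the relations are two linear equations for `r j k` and `r k j`, solvable off
  -- the diagonal because `w j ≠ w k`. On the diagonal both equations hold with `r j j = 1`, thanks
  -- to the normalization `a² = 1 - w`, `b² = 1 + w`.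
  set r : n → n → ℝ := fun j k => if j = k then 1 else
    (-w j * (a j * a k + b j * b k) - (a j * a k - b j * b k)) / (w k - w j) with hr
  have hE0 : ∀ j, asymptoticHalfSpins w 0 j = a j := fun j => rfl
  have hE1 : ∀ j, asymptoticHalfSpins w 1 j = b j := fun j => rfl
  have hne : ∀ {j k}, j ≠ k → w k - w j ≠ 0 := fun hjk => sub_ne_zero.2 fun e => hjk (hinj e.symm)
  have r1 : ∀ j k, r j k + r k j = a j * a k + b j * b k := by
    intro j k
    by_cases hjk : j = k
    · subst hjk
      simp only [hr, if_true]
      linarith [ha2 j, hb2 j]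
    · have h1 := hne hjk
      have h2 := hne (Ne.symm hjk)
      simp only [hr, if_neg hjk, if_neg (Ne.symm hjk)]
      field_simp
      ring
  have r2 : ∀ j k, r j k * w k + w j * r k j = -(a j * a k - b j * b k) := by
    intro j k
    by_cases hjk : j = k
    · subst hjk
      simp only [hr, if_true]
      linarith [ha2 j, hb2 j]
    · have h1 := hne hjk
      have h2 := hne (Ne.symm hjk)
      simp only [hr, if_neg hjk, if_neg (Ne.symm hjk)]
      field_simp
      ring
  refine ⟨Matrix.of fun j k => Complex.I * r j k, ⟨?_, ?_, ?_⟩⟩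
  · rw [Matrix.diagonal_conjTranspose]
    congr 1
    funext j
    simp
  · ext j k
    have := congrArg (fun z : ℝ => (z : ℂ)) (r1 j k)
    push_cast at this
    simp only [Matrix.sub_apply, Matrix.conjTranspose_apply, Matrix.of_apply, Matrix.smul_apply,
      Matrix.mul_apply, Fin.sum_univ_two, hE0, hE1, smul_eq_mul, star_mul', Complex.star_def,
      Complex.conj_I, Complex.conj_ofReal]
    linear_combination Complex.I * this
  · ext j k
    have := congrArg (fun z : ℝ => (z : ℂ)) (r2 j k)
    push_cast at this
    rw [Matrix.sub_apply, Matrix.mul_diagonal, Matrix.diagonal_mul, Matrix.smul_apply,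
      Matrix.mul_apply, Fin.sum_univ_two, pauliZ, Matrix.mul_diagonal, Matrix.mul_diagonal]
    simp only [Matrix.conjTranspose_apply, Matrix.of_apply, hE0, hE1, smul_eq_mul, star_mul',
      Complex.star_def, Complex.conj_I, Complex.conj_ofReal, Matrix.cons_val_zero,
      Matrix.cons_val_one, Matrix.cons_val_fin_one]
    linear_combination Complex.I * this

theorem exists_strict_approximation {ι : Type*} {ω : ι → ℝ} (hω : Function.Injective ω)
    (hω_le : ∀ j, |ω j| ≤ 1) {ε : ℝ} (hε : 0 < ε) :
    ∃ w : ι → ℝ, Function.Injective w ∧ (∀ j, |w j| < 1) ∧ ∀ j, |w j - ω j| ≤ ε := by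
  -- Contracting by `1 - η` moves each `ω j` by at most `η ≤ ε`; `η < 1` keeps the values distinct.
  set η := min ε (1 / 2) with hη
  have h0 : 0 < η := lt_min hε (by norm_num)
  have h1 : η ≤ 1 / 2 := min_le_right _ _
  have h2 : η ≤ ε := min_le_left _ _
  refine ⟨fun j => (1 - η) * ω j, fun j k hjk => hω ?_, fun j => ?_, fun j => ?_⟩
  · exact mul_left_cancel₀ (by linarith : (1 - η) ≠ 0) hjk
  · rw [abs_mul, abs_of_pos (by linarith : 0 < 1 - η)]
    nlinarith [hω_le j, abs_nonneg (ω j)]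
  · have : (1 - η) * ω j - ω j = -(η * ω j) := by ring
    rw [this, abs_neg, abs_mul, abs_of_pos h0]
    nlinarith [hω_le j, abs_nonneg (ω j)]

end Data

/-! ### Assembly of the solution -/

theorem mainTheorem5 (N : ℕ) (ε : ℝ) (hε : 0 < ε) (ω : Fin N → ℝ)
    (hω : Function.Injective ω) (hω_le : ∀ j, |ω j| ≤ 1) :
    ∃ (m : ℝ → ℝ → Fin 3 → ℝ) (m₀ : Fin 3 → ℝ) (s : ℝ → Fin N → Fin 3 → ℂ)
      (x xdot : ℝ → Fin N → ℂ) (v : Fin N → ℂ),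
      IsGlobalHWMSolution m ∧
      IsRationalWith m m₀ s x ∧
      (∀ t : ℝ, 0 ≤ t → ∀ j,
        HasDerivWithinAt (fun τ => x τ j) (xdot t j) (Set.Ici 0) t) ∧
      IsSpectrum (s 0) (x 0) (xdot 0) v ∧
      (∀ j, ‖v j - (ω j : ℂ)‖ ≤ ε) ∧
      (∀ t : ℝ, 0 ≤ t → ∀ j, ‖xdot t j - (ω j : ℂ)‖ ≤ ε) := by
  obtain ⟨w, hw, hw1, hwω⟩ := exists_strict_approximation hω hω_le (half_pos hε)
  obtain ⟨B, hB⟩ := exists_laxRelations hw hw1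
  set v : Fin N → ℂ := fun j => (w j : ℂ) with hv
  have hvinj : Function.Injective v := fun j k hjk => hw (Complex.ofReal_injective hjk)
  set E := asymptoticHalfSpins w with hEdef
  have hE : ∀ a k, E a k ≠ 0 := asymptoticHalfSpins_ne_zero hw1
  set W := Matrix.diagonal v with hWdef
  set F := coSpin W E with hF
  have hvω : ∀ j, ‖v j - (ω j : ℂ)‖ ≤ ε / 2 := by
    intro j
    rw [hv, ← Complex.ofReal_sub, Complex.norm_real, Real.norm_eq_abs]
    exact hwω j
  obtain ⟨K, l, l', hl⟩ := exists_eigenvalues_add_smul_diagonal B hvinj (half_pos hε)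
  -- The strict inequality `T > K` leaves a two-sided neighbourhood of time zero, so even the
  -- derivative there is an ordinary one.
  set T := K + 1 with hT
  have hTt : ∀ t : ℝ, 0 ≤ t → K < T + t := fun t ht => by linarith
  set M : ℝ → Matrix (Fin N) (Fin N) ℂ := fun t => B + ((T + t : ℝ) : ℂ) • W with hMdef
  have hrel : ∀ t, LaxRelations (M t) W E := fun t => hB.add_smul (T + t)
  have hlinj : ∀ t : ℝ, 0 ≤ t → Function.Injective (l (T + t)) := fun t ht => (hl _ (hTt t ht)).1
  have hdiag : ∀ t : ℝ, 0 ≤ t → ∃ V V' : Matrix (Fin N) (Fin N) ℂ, V * V' = 1 ∧ V' * V = 1 ∧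
      M t = V * Matrix.diagonal (l (T + t)) * V' := fun t ht =>
    exists_diagonalization (hlinj t ht) fun j => ((hl _ (hTt t ht)).2 j).2.1
  -- The eigenbasis is chosen separately at each time, with no continuity in `t`: time derivatives
  -- are taken only of resolvents and of the branches `l`.
  choose! V V' hV hV' hM using hdiag
  have him : ∀ t : ℝ, 0 ≤ t → ∀ j, 0 < (l (T + t) j).im := fun t ht =>
    (hrel t).im_pos hvinj (hE 0) (hlinj t ht) (hV t ht) (hV' t ht) (hM t ht)
  have hres := fun (t : ℝ) (ht : 0 ≤ t) =>
    resolvent_diagonalization (hV t ht) (hV' t ht) (hM t ht) (him t ht)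
  have hxder : ∀ t : ℝ, 0 ≤ t → ∀ j, HasDerivAt (fun τ => l (T + τ) j) (l' (T + t) j) t :=
    fun t ht j => ((hl _ (hTt t ht)).2 j).1.comp_const_add T t
  refine ⟨fun t => waveMap (M t) W E, ![0, 0, 1], fun t => spinOf E F (V t) (V' t),
    fun t => l (T + t), fun t => l' (T + t), v, ⟨?_, ?_, ?_⟩, ⟨him, hlinj, ?_, ?_⟩, ?_, ?_, ?_, ?_⟩
  · intro t ht y
    exact (hrel t).waveMap_dotProduct_self (hres t ht y).1
  · intro t ht y
    exact (hasDerivAt_waveMap W E (hres t ht y).1).differentiableAt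
  · intro t ht y
    refine ⟨_, fun i => isHilbertTransformAt_deriv_waveMap W E (hV t ht) (hV' t ht) (hM t ht)
      (him t ht) y i, ?_⟩
    have h1 := (hasDerivAt_waveMap_time B W E y rfl (hres t ht y).1).hasDerivWithinAt
      (s := Set.Ici 0)
    refine h1.congr_deriv ?_
    funext i
    exact (hrel t).waveMap_cross (hres t ht y).1 rfl i
  · intro t ht j
    exact (hrel t).spinOf_ne_zero (hV' t ht) (hM t ht) j
      ((hrel t).halfSpin_ne_zero hvinj (hE 0) (hlinj t ht) (hV t ht) (hV' t ht) (hM t ht) j)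
      ((hrel t).coHalfSpin_ne_zero hvinj hE (hlinj t ht) (hV t ht) (hV' t ht) (hM t ht) j)
  · intro t ht y i
    rw [waveMap, (hres t ht y).2, sandwichCoord_diagonal, Complex.ofReal_add, ← Complex.add_conj,
      map_sum]
    simp only [map_mul, map_inv₀, map_sub, Complex.conj_ofReal, div_eq_mul_inv]
    exact (add_assoc _ _ _).symm
  · exact fun t ht j => (hxder t ht j).hasDerivWithinAt
  · have hd : ∀ j, l' (T + 0) j = (V' 0 * W * V 0) j j := by
      intro j
      have h0 := hTt 0 le_rfl
      refine eigenvalue_derivative (hlinj 0 le_rfl) (hV' 0 le_rfl) (hM 0 le_rfl)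
        ((hl _ h0).2 j).1 rfl ?_
      filter_upwards [lt_mem_nhds h0] with τ hτ
      exact ((hl τ hτ).2 j).2.1
    exact (hrel 0).isSpectrum (hV 0 le_rfl) (hV' 0 le_rfl) (hlinj 0 le_rfl) (hM 0 le_rfl) hd
  · intro j
    linarith [hvω j]
  · intro t ht j
    have h1 := ((hl _ (hTt t ht)).2 j).2.2
    have h2 := norm_sub_le_norm_sub_add_norm_sub (l' (T + t) j) (v j) (ω j : ℂ)
    linarith [hvω j]
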